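/- Let $M=(m_{st})$ be a Coxeter matrix on a set $S$ with Coxeter group $W$. Weyl data $\mathcal W$ of type $M$ consists of a set of chambers; for each $s\in S$, a groupoid (the panel groupoid of type $s$) whose vertex set is the set of chambers; and, for all $s\ne t$ in $S$ with $m_{st}<\infty$, a set of $(s,t)$-cycles, called defining $(s,t)$-suites. Here the edges (of type $s$) of $\mathcal W$ are the non-identity edges of the panel groupoids, a gallery is a finite path of edges, its type is the word of the types of its edges, its $W$-length is the element of $W$ represented by its type, and an $(s,t)$-cycle is a closed gallery of type $stst\cdots$ of length $2m_{st}$. Two galleries are homotopic if they are related by a finite sequence of the following alterations of subgalleries and their inverses: delete an edge followed by its inverse; replace two consecutive edges of the same type, not mutually inverse, by their composition in the panel groupoid; delete a defining suite. The fundamental groupoid $\overline{\mathcal W}$ has the chambers as vertices and the homotopy classes of galleries as edges. An $(s,t)$-suite is an $(s,t)$-cycle (with $s\neq t$, $m_{st}<\infty$) that is homotopic to a trivial gallery. A geodesic is a gallery whose type is a reduced word, and a maximal $(s,t)$-geodesic ($s\ne t$, $m_{st}<\infty$) is a gallery of type $stst\cdots$ of length $m_{st}$. $\mathcal W$ is a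 Weyl graph if (PW0) no connected component of a panel groupoid is the trivial groupoid with one edge; (PW1) each maximal $(s,t)$-geodesic is homotopic to a maximal $(t,s)$-geodesic; (W) homotopic geodesics have the same $W$-length. For $J\subseteq S$, the $J$-restriction $\mathcal W_J$ is the Weyl data over $J$ with the same chambers, the panel groupoids of types $s\in J$, and the defining $(s,t)$-suites of $\mathcal W$ with $s,t\in J$. Let $\mathcal W_J^{\mathrm{sat}}$ be the same with, as defining suites, all $(s,t)$-suites of $\mathcal W$ with $s,t\in J$. The $J$-residue at a chamber $C$, in either version, is the connected component of $C$ in the $J$-restriction. A homomorphism of groupoids is an embedding if it is injective on edges. **Corollary.** Let $\mathcal W$ be a Weyl graph of type $M$ over $S$, and let $J\subseteq S$. 1. The internal homomorphism $\overline{\mathcal W_J^{\mathrm{sat}}}\to\overline{\mathcal W}$, $[\beta]\mapsto[\beta]$, is an embedding; and any two geodesics in a $J$-residue of $\mathcal W_J^{\mathrm{sat}}$ which are homotopic in $\mathcal W$ are homotopic in that residue. 2. The internal homomorphism $\overline{\mathcal W_J}\to\overline{\mathcal W}$, $[\beta]\mapsto[\beta]$, is an embedding if and only if $\mathcal W_J$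 satisfies (PW1). In this case, any two geodesics in a $J$-residue of $\mathcal W_J$ which are homotopic in $\mathcal W$ are homotopic in that residue. -/

import Mathlib

open CategoryTheory

universe u v u₁ v₁ u₃

/-! ### Words and Coxeter matrices -/

/-- The alternating word `s t s t ⋯` of length `m` which begins with the letter `s`. -/
def altWord {S : Type*} (s t : S) : ℕ → List S
  | 0 => []
  | m + 1 => s :: altWord t s m

theorem altWord_map {S : Type*} {S' : Type*} (f : S' → S) (s t : S') (m : ℕ) :
    (altWord s t m).map f = altWord (f s) (f t) m := by
  induction m generalizing s t with
  | zero => rfl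
  | succ m ih => simp [altWord, ih]

/-- The restriction of a Coxeter matrix on `S` to a subset `J` of `S`.
(An entry `0` of a Coxeter matrix stands for `∞`.) -/
def CoxeterMatrix.restrict {S : Type*} (M : CoxeterMatrix S) (J : Set S) : CoxeterMatrix J where
  M := fun s t => M s t
  isSymm := by ext s t; exact M.symmetric t s
  diagonal := fun s => M.diagonal s
  off_diagonal := fun s t h => M.off_diagonal s t (fun h' => h (Subtype.ext h'))

/-! ### Generalized chamber systems and galleries -/

/-- A generalized chamber system over `S`: a set of chambers together with, for every `s : S`, a
groupoid whose set of vertices is the set of chambers (the panel groupoid of type `s`). -/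
structure GeneralizedChamberSystem (S : Type*) where
  Chamber : Type u
  panel : S → Groupoid.{v} Chamber

namespace GeneralizedChamberSystem

section
variable {S : Type*} (W : GeneralizedChamberSystem.{u, v} S)

/-- The set of edges from `x` to `y` in the panel groupoid of type `s`, trivial edges included. -/
abbrev PanelHom (s : S) (x y : W.Chamber) : Type v := (W.panel s).Hom x y

/-- The trivial edges. -/
def panelId (s : S) (x : W.Chamber) : W.PanelHom s x x := (W.panel s).id x

/-- The composition `g ; h` in the panel groupoid of type `s`. -/
def panelComp {s : S} {x y z : W.Chamber} (g : W.PanelHom s x y) (h : W.PanelHom s y z) :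
    W.PanelHom s x z := (W.panel s).comp g h

/-- The inverse in the panel groupoid of type `s`. -/
def panelInv {s : S} {x y : W.Chamber} (g : W.PanelHom s x y) : W.PanelHom s y x :=
  (W.panel s).inv g

/-- An edge of a panel groupoid is trivial if it is an identity. -/
def IsTrivial {s : S} {x y : W.Chamber} (g : W.PanelHom s x y) : Prop :=
  x = y ∧ HEq g (W.panelId s x)

theorem panelInv_panelInv {s : S} {x y : W.Chamber} (g : W.PanelHom s x y) :
    W.panelInv (W.panelInv g) = g := by
  let _ := W.panel s
  change Groupoid.inv (Groupoid.inv (show x ⟶ y from g)) = g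
  simp

theorem panelInv_panelId (s : S) (x : W.Chamber) :
    W.panelInv (W.panelId s x) = W.panelId s x := by
  let _ := W.panel s
  change Groupoid.inv (𝟙 x) = 𝟙 x
  simp

theorem panelInv_panelComp_self {s : S} {x y : W.Chamber} (g : W.PanelHom s x y) :
    W.panelComp (W.panelInv g) g = W.panelId s y := (W.panel s).inv_comp g

theorem eq_panelInv {s : S} {x y : W.Chamber} {g : W.PanelHom s x y} {h : W.PanelHom s y x}
    (hh : W.panelComp h g = W.panelId s y) : h = W.panelInv g := by
  have h₁ : W.panelComp h (W.panelComp g (W.panelInv g)) = h :=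
    (congrArg (W.panelComp h) ((W.panel s).comp_inv g)).trans ((W.panel s).comp_id h)
  have h₂ : W.panelComp (W.panelComp h g) (W.panelInv g) =
    W.panelComp h (W.panelComp g (W.panelInv g)) := (W.panel s).assoc h g (W.panelInv g)
  rw [← h₁, ← h₂, hh]
  exact (W.panel s).id_comp (W.panelInv g)

theorem not_isTrivial_panelInv {s : S} {x y : W.Chamber} {g : W.PanelHom s x y}
    (hg : ¬ W.IsTrivial g) : ¬ W.IsTrivial (W.panelInv g) := by
  rintro ⟨h, h'⟩
  subst h
  apply hg
  refine ⟨rfl, heq_of_eq ?_⟩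
  rw [← W.panelInv_panelInv g, eq_of_heq h', panelInv_panelId]

/-- An edge of the labelled graph underlying `W`: a non-trivial edge of one of the panel
groupoids. -/
structure Edge (x y : W.Chamber) where
  type : S
  hom : W.PanelHom type x y
  nontrivial : ¬ W.IsTrivial hom

instance graph : Quiver W.Chamber := ⟨W.Edge⟩

/-- The inverse of an edge in its panel groupoid. -/
instance graphHasReverse : Quiver.HasReverse W.Chamber where
  reverse' e := ⟨e.type, W.panelInv e.hom, W.not_isTrivial_panelInv e.nontrivial⟩

/-- Galleries from `x` to `y`: paths in the underlying graph, that is, finite sequences of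
consecutive edges. Concatenation is `Quiver.Path.comp`, the inverse is `Quiver.Path.reverse`. -/
abbrev Gallery (x y : W.Chamber) := Quiver.Path x y

/-- The gallery which consists of one edge. -/
def single {s : S} {x y : W.Chamber} (g : W.PanelHom s x y) (hg : ¬ W.IsTrivial g) :
    W.Gallery x y :=
  Quiver.Path.cons Quiver.Path.nil (Edge.mk s g hg)

variable {W}

/-- The type of a gallery: the sequence of the types of its edges. -/
def Gallery.types {x : W.Chamber} : {y : W.Chamber} → W.Gallery x y → List S
  | _, Quiver.Path.nil => []
  | _, Quiver.Path.cons p e => Gallery.types p ++ [Edge.type e]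

variable (W)

/-- The `J`-restriction of a generalized chamber system. -/
def restrict (J : Set S) : GeneralizedChamberSystem.{u, v} J where
  Chamber := W.Chamber
  panel := fun s => W.panel s

/-- The full subsystem on a set of chambers. -/
def full (X : Set W.Chamber) : GeneralizedChamberSystem.{u, v} S where
  Chamber := X
  panel := fun s =>
    { Hom := fun x y => (W.panel s).Hom x y
      id := fun x => (W.panel s).id x
      comp := fun g h => (W.panel s).comp g h
      id_comp := fun g => (W.panel s).id_comp g
      comp_id := fun g => (W.panel s).comp_id g
      assoc := fun g h k => (W.panel s).assoc g h k
      inv := fun g => (W.panel s).inv g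
      inv_comp := fun g => (W.panel s).inv_comp g
      comp_inv := fun g => (W.panel s).comp_inv g }

end

/-- A morphism of generalized chamber systems over a map of labels `f`: a map of chambers with,
for each label, a homomorphism of panel groupoids which has a trivial kernel. -/
structure Morphism {S' : Type*} {S : Type*} (f : S' → S)
    (V : GeneralizedChamberSystem.{u₁, v₁} S') (W : GeneralizedChamberSystem.{u, v} S) where
  chamber : V.Chamber → W.Chamber
  hom : ∀ {s : S'} {x y : V.Chamber}, V.PanelHom s x y → W.PanelHom (f s) (chamber x) (chamber y)
  hom_id : ∀ (s : S') (x : V.Chamber), hom (V.panelId s x) = W.panelId (f s) (chamber x)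
  hom_comp : ∀ {s : S'} {x y z : V.Chamber} (g : V.PanelHom s x y) (h : V.PanelHom s y z),
    hom (V.panelComp g h) = W.panelComp (hom g) (hom h)
  nontrivial : ∀ {s : S'} {x y : V.Chamber} (g : V.PanelHom s x y),
    ¬ V.IsTrivial g → ¬ W.IsTrivial (hom g)

namespace Morphism

variable {S' : Type*} {S : Type*} {f : S' → S}
  {V : GeneralizedChamberSystem.{u₁, v₁} S'} {W : GeneralizedChamberSystem.{u, v} S}

/-- The morphism of graphs which underlies a morphism of generalized chamber systems. -/
def prefunctor (ω : Morphism f V W) : V.Chamber ⥤q W.Chamber where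
  obj := ω.chamber
  map e := ⟨f e.type, ω.hom e.hom, ω.nontrivial e.hom e.nontrivial⟩

/-- The image `ω ∘ β` of a gallery under a morphism. -/
def gallery (ω : Morphism f V W) {x y : V.Chamber} (β : V.Gallery x y) :
    W.Gallery (ω.chamber x) (ω.chamber y) := ω.prefunctor.mapPath β

theorem hom_inv (ω : Morphism f V W) {s : S'} {x y : V.Chamber} (g : V.PanelHom s x y) :
    ω.hom (V.panelInv g) = W.panelInv (ω.hom g) := by
  apply W.eq_panelInv
  rw [← ω.hom_comp, V.panelInv_panelComp_self, ω.hom_id]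

theorem types_gallery (ω : Morphism f V W) {x y : V.Chamber} (β : V.Gallery x y) :
    (ω.gallery β).types = β.types.map f := by
  induction β with
  | nil => rfl
  | cons p e ih =>
    change Gallery.types (ω.gallery p) ++ [f (Edge.type e)] =
      (Gallery.types p ++ [Edge.type e]).map f
    rw [ih]; simp

theorem gallery_comp (ω : Morphism f V W) {x y z : V.Chamber} (β : V.Gallery x y)
    (β' : V.Gallery y z) :
    ω.gallery (Quiver.Path.comp β β') = Quiver.Path.comp (ω.gallery β) (ω.gallery β') :=
  Prefunctor.mapPath_comp _ β β'

end Morphism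

/-- The inclusion of the `J`-restriction. -/
def restrictInclusion {S : Type*} (W : GeneralizedChamberSystem.{u, v} S) (J : Set S) :
    Morphism (Subtype.val : J → S) (W.restrict J) W where
  chamber := fun x => x
  hom := fun g => g
  hom_id := fun _ _ => rfl
  hom_comp := fun _ _ => rfl
  nontrivial := fun _ hg => hg

/-- The inclusion of a full subsystem. -/
def fullInclusion {S : Type*} (W : GeneralizedChamberSystem.{u, v} S) (X : Set W.Chamber) :
    Morphism (id : S → S) (W.full X) W where
  chamber := Subtype.val
  hom := fun g => g
  hom_id := fun _ _ => rfl
  hom_comp := fun _ _ => rfl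
  nontrivial := by
    intro s x y g hg hg'
    obtain ⟨h, h'⟩ := hg'
    have hxy : x = y := Subtype.ext h
    subst hxy
    exact hg ⟨rfl, h'⟩

end GeneralizedChamberSystem

open GeneralizedChamberSystem

/-! ### Weyl data and homotopy -/

/-- Weyl data of type `M`: a generalized chamber system with, for all `s ≠ t` with `m_{st} < ∞`, a
set of `(s,t)`-cycles (closed galleries of type `s t s t ⋯`, of length `2 m_{st}`), called the
defining `(s,t)`-suites. `defSuite s t x` is the set of those which begin at `x`. -/
structure WeylData {S : Type*} (M : CoxeterMatrix S) extends GeneralizedChamberSystem.{u, v} S where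
  defSuite : ∀ (s t : S) (x : Chamber), Set (toGeneralizedChamberSystem.Gallery x x)
  defSuite_spec : ∀ (s t : S) (x : Chamber) (θ : toGeneralizedChamberSystem.Gallery x x),
    θ ∈ defSuite s t x → s ≠ t ∧ M s t ≠ 0 ∧ Gallery.types θ = altWord s t (2 * M s t)

namespace WeylData

section
variable {S : Type u₃} {M : CoxeterMatrix S} (W : WeylData.{u, v} M)

/-- The local moves: delete a backtrack, take a shortcut, delete a defining suite. -/
inductive Move : {x y : W.Chamber} → W.Gallery x y → W.Gallery x y → Prop
  | backtrack {s : S} {x y : W.Chamber} (g : W.PanelHom s x y) (hg : ¬ W.IsTrivial g) :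
      Move (Quiver.Path.comp (W.single g hg)
        (W.single (W.panelInv g) (W.not_isTrivial_panelInv hg))) Quiver.Path.nil
  | shortcut {s : S} {x y z : W.Chamber} (g : W.PanelHom s x y) (h : W.PanelHom s y z)
      (hg : ¬ W.IsTrivial g) (hh : ¬ W.IsTrivial h) (hgh : ¬ W.IsTrivial (W.panelComp g h)) :
      Move (Quiver.Path.comp (W.single g hg) (W.single h hh)) (W.single (W.panelComp g h) hgh)
  | suite {s t : S} {x : W.Chamber} (θ : W.Gallery x x) (hθ : θ ∈ W.defSuite s t x) :
      Move θ Quiver.Path.nil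

/-- A contraction applies a local move to a subgallery. -/
inductive Contraction {x y : W.Chamber} : W.Gallery x y → W.Gallery x y → Prop
  | mk {a b : W.Chamber} (p : W.Gallery x a) (c d : W.Gallery a b) (q : W.Gallery b y)
      (h : W.Move c d) :
      Contraction (Quiver.Path.comp p (Quiver.Path.comp c q))
        (Quiver.Path.comp p (Quiver.Path.comp d q))

/-- Homotopy of galleries: a composition of contractions and of their inverses. -/
def Homotopic {x y : W.Chamber} : W.Gallery x y → W.Gallery x y → Prop :=
  Relation.EqvGen W.Contraction

/-- A closed gallery is null-homotopic if it is homotopic to the trivial gallery. -/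
def NullHomotopic {x : W.Chamber} (θ : W.Gallery x x) : Prop :=
  W.Homotopic θ Quiver.Path.nil

/-- An `(s,t)`-suite: a null-homotopic `(s,t)`-cycle, where `s ≠ t` and `m_{st} < ∞`. -/
def IsSuite (s t : S) {x : W.Chamber} (θ : W.Gallery x x) : Prop :=
  s ≠ t ∧ M s t ≠ 0 ∧ Gallery.types θ = altWord s t (2 * M s t) ∧ W.NullHomotopic θ

/-- The `W`-length of a gallery, an element of the Coxeter group of type `M`. -/
def wLength {x y : W.Chamber} (β : W.Gallery x y) : M.Group :=
  M.toCoxeterSystem.wordProd (Gallery.types β)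

/-- A geodesic is a gallery whose type is a reduced word. -/
def IsGeodesic {x y : W.Chamber} (β : W.Gallery x y) : Prop :=
  M.toCoxeterSystem.IsReduced (Gallery.types β)

/-- A maximal `(s,t)`-geodesic is a gallery of type `s t s t ⋯`, of length `m_{st} < ∞`. -/
def IsMaxGeodesic (s t : S) {x y : W.Chamber} (ρ : W.Gallery x y) : Prop :=
  s ≠ t ∧ M s t ≠ 0 ∧ Gallery.types ρ = altWord s t (M s t)

/-- No panel is the trivial groupoid with one edge: every chamber has, in each panel groupoid, a
non-trivial edge which begins there. -/
def PW0 : Prop :=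
  ∀ (s : S) (x : W.Chamber), ∃ (y : W.Chamber) (g : W.PanelHom s x y), ¬ W.IsTrivial g

/-- Each maximal `(s,t)`-geodesic is homotopic to a maximal `(t,s)`-geodesic. -/
def PW1 : Prop :=
  ∀ (s t : S) (x y : W.Chamber) (ρ : W.Gallery x y), W.IsMaxGeodesic s t ρ →
    ∃ ρ' : W.Gallery x y, W.IsMaxGeodesic t s ρ' ∧ W.Homotopic ρ ρ'

/-- Homotopic geodesics have the same `W`-length. -/
def PropertyW : Prop :=
  ∀ (x y : W.Chamber) (γ γ' : W.Gallery x y), W.IsGeodesic γ → W.IsGeodesic γ' →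
    W.Homotopic γ γ' → W.wLength γ = W.wLength γ'

/-- Pre-Weyl graphs. -/
structure IsPreWeylGraph : Prop where
  pw0 : W.PW0
  pw1 : W.PW1

/-- Weyl graphs. -/
structure IsWeylGraph : Prop extends W.IsPreWeylGraph where
  propertyW : W.PropertyW

/-- The setoid of homotopy. -/
def homotopySetoid (x y : W.Chamber) : Setoid (W.Gallery x y) :=
  Relation.EqvGen.setoid W.Contraction

variable {W}

theorem Homotopic.refl {x y : W.Chamber} (β : W.Gallery x y) : W.Homotopic β β :=
  Relation.EqvGen.refl _

theorem Homotopic.symm {x y : W.Chamber} {β γ : W.Gallery x y} (h : W.Homotopic β γ) :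
    W.Homotopic γ β := Relation.EqvGen.symm _ _ h

theorem Homotopic.trans {x y : W.Chamber} {β γ δ : W.Gallery x y} (h : W.Homotopic β γ)
    (h' : W.Homotopic γ δ) : W.Homotopic β δ := Relation.EqvGen.trans _ _ _ h h'

theorem Homotopic.of_move {x y : W.Chamber} {β γ : W.Gallery x y} (h : W.Move β γ) :
    W.Homotopic β γ := by
  have := Contraction.mk Quiver.Path.nil β γ Quiver.Path.nil h
  simp only [Quiver.Path.nil_comp, Quiver.Path.comp_nil] at this
  exact Relation.EqvGen.rel _ _ this

/-- A homotopy can be applied to a subgallery. -/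
theorem Homotopic.whisker {a x y b : W.Chamber} {β γ : W.Gallery x y} (h : W.Homotopic β γ)
    (p : W.Gallery a x) (q : W.Gallery y b) :
    W.Homotopic (Quiver.Path.comp p (Quiver.Path.comp β q))
      (Quiver.Path.comp p (Quiver.Path.comp γ q)) := by
  induction h with
  | rel β γ h =>
    obtain ⟨p', c, d, q', h⟩ := h
    have := Contraction.mk (p.comp p') c d (q'.comp q) h
    simp only [Quiver.Path.comp_assoc] at this ⊢
    exact Relation.EqvGen.rel _ _ this
  | refl β => exact Homotopic.refl _
  | symm β γ _ ih => exact ih.symm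
  | trans β γ δ _ _ ih ih' => exact ih.trans ih'

theorem Homotopic.comp {x y z : W.Chamber} {β γ : W.Gallery x y} {β' γ' : W.Gallery y z}
    (h : W.Homotopic β γ) (h' : W.Homotopic β' γ') :
    W.Homotopic (Quiver.Path.comp β β') (Quiver.Path.comp γ γ') := by
  have h₁ := h.whisker Quiver.Path.nil β'
  have h₂ := h'.whisker γ Quiver.Path.nil
  simp only [Quiver.Path.nil_comp, Quiver.Path.comp_nil] at h₁ h₂
  exact h₁.trans h₂

/-- A gallery followed by its inverse is null-homotopic. -/
theorem comp_reverse {x y : W.Chamber} (β : W.Gallery x y) :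
    W.Homotopic (Quiver.Path.comp β (Quiver.Path.reverse β)) Quiver.Path.nil := by
  induction β with
  | nil => exact Homotopic.refl _
  | cons p e ih =>
    refine Homotopic.trans ?_ ih
    have h := (Homotopic.of_move (Move.backtrack e.hom e.nontrivial)).whisker p
      (Quiver.Path.reverse p)
    simp only [Quiver.Path.nil_comp] at h
    have hE : Quiver.Path.comp (Quiver.Path.cons p e)
        (Quiver.Path.reverse (Quiver.Path.cons p e)) =
      Quiver.Path.comp p (Quiver.Path.comp (Quiver.Path.comp (W.single e.hom e.nontrivial)
        (W.single (W.panelInv e.hom) (W.not_isTrivial_panelInv e.nontrivial)))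
        (Quiver.Path.reverse p)) := by
      rw [← Quiver.Path.comp_assoc, ← Quiver.Path.comp_assoc]
      change Quiver.Path.comp _ (Quiver.Path.comp _ _) = _
      rw [← Quiver.Path.comp_assoc]
      rfl
    rw [hE]
    exact h

theorem reverse_reverse {x y : W.Chamber} (β : W.Gallery x y) :
    Quiver.Path.reverse (Quiver.Path.reverse β) = β := by
  induction β with
  | nil => rfl
  | cons p e ih =>
    change Quiver.Path.reverse (Quiver.Path.comp _ _) = _
    rw [Quiver.Path.reverse_comp, ih, Quiver.Path.reverse_toPath]
    have : Quiver.reverse (Quiver.reverse e) = e := by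
      obtain ⟨s, g, hg⟩ := e
      change Edge.mk s (W.panelInv (W.panelInv g)) _ = Edge.mk s g hg
      congr 1
      exact W.panelInv_panelInv g
    rw [this]
    rfl

theorem reverse_comp_self {x y : W.Chamber} (β : W.Gallery x y) :
    W.Homotopic (Quiver.Path.comp (Quiver.Path.reverse β) β) Quiver.Path.nil := by
  have := comp_reverse (W := W) (Quiver.Path.reverse β)
  rwa [reverse_reverse] at this

theorem Homotopic.reverse {x y : W.Chamber} {β γ : W.Gallery x y} (h : W.Homotopic β γ) :
    W.Homotopic (Quiver.Path.reverse β) (Quiver.Path.reverse γ) := by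
  have h₁ := (reverse_comp_self (W := W) β).comp (Homotopic.refl (Quiver.Path.reverse γ))
  have h₂ := (Homotopic.refl (Quiver.Path.reverse β)).comp (comp_reverse (W := W) γ)
  have h₃ := ((Homotopic.refl (Quiver.Path.reverse β)).comp h).comp
    (Homotopic.refl (Quiver.Path.reverse γ))
  simp only [Quiver.Path.nil_comp, Quiver.Path.comp_nil, Quiver.Path.comp_assoc] at h₁ h₂ h₃
  exact (h₂.symm.trans (h₃.symm.trans h₁))

variable (W)

/-- The set of vertices of the fundamental groupoid: the chambers. -/
def FundamentalGroupoid : Type u := W.Chamber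

/-- The fundamental groupoid: its edges are the homotopy classes of galleries. -/
instance fundamentalGroupoid : Groupoid W.FundamentalGroupoid where
  Hom x y := Quotient (W.homotopySetoid x y)
  id x := Quotient.mk (W.homotopySetoid x x) (Quiver.Path.nil (V := W.Chamber))
  comp {x y z} a b := Quotient.map₂ (sa := W.homotopySetoid x y) (sb := W.homotopySetoid y z)
    (sc := W.homotopySetoid x z) (fun β γ => Quiver.Path.comp β γ)
    (fun _ _ h _ _ h' => Homotopic.comp h h') a b
  inv {x y} a := Quotient.map (sa := W.homotopySetoid x y) (sb := W.homotopySetoid y x)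
    (fun β => Quiver.Path.reverse β) (fun _ _ h => Homotopic.reverse h) a
  id_comp a := by
    induction a using Quotient.inductionOn with
    | h β => exact congrArg (Quotient.mk _) (Quiver.Path.nil_comp β)
  comp_id a := by
    induction a using Quotient.inductionOn with
    | h β => rfl
  assoc a b c := by
    induction a using Quotient.inductionOn with
    | h β => induction b using Quotient.inductionOn with
      | h γ => induction c using Quotient.inductionOn with
        | h δ => exact congrArg (Quotient.mk _) (Quiver.Path.comp_assoc β γ δ)
  inv_comp a := by
    induction a using Quotient.inductionOn with
    | h β => exact Quotient.sound (reverse_comp_self β)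
  comp_inv a := by
    induction a using Quotient.inductionOn with
    | h β => exact Quotient.sound (comp_reverse β)

end

/-! ### Morphisms and induced homomorphisms of fundamental groupoids -/

/-- A morphism of Weyl data over a map of labels: a morphism of generalized chamber systems which
maps defining suites to null-homotopic galleries. -/
structure Morphism {S' : Type*} {S : Type*} (f : S' → S) {N : CoxeterMatrix S'}
    {M : CoxeterMatrix S} (V : WeylData.{u₁, v₁} N) (W : WeylData.{u, v} M) extends
    GeneralizedChamberSystem.Morphism f V.toGeneralizedChamberSystem
      W.toGeneralizedChamberSystem where
  suite : ∀ (s t : S') (x : V.Chamber) (θ : V.Gallery x x), θ ∈ V.defSuite s t x →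
    W.NullHomotopic (toMorphism.gallery θ)

namespace Morphism

variable {S' : Type*} {S : Type*} {f : S' → S} {N : CoxeterMatrix S'} {M : CoxeterMatrix S}
  {V : WeylData.{u₁, v₁} N} {W : WeylData.{u, v} M}

theorem single_congr {s : S} {x y : W.Chamber} {g h : W.PanelHom s x y} (e : g = h)
    (hg : ¬ W.IsTrivial g) (hh : ¬ W.IsTrivial h) : W.single g hg = W.single h hh := by
  subst e; rfl

theorem move (ω : Morphism f V W) {x y : V.Chamber} {β γ : V.Gallery x y} (h : V.Move β γ) :
    W.Homotopic (ω.gallery β) (ω.gallery γ) := by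
  induction h with
  | backtrack g hg =>
    have h := Homotopic.of_move (Move.backtrack (W := W) (ω.hom g) (ω.nontrivial g hg))
    rw [ω.gallery_comp]
    have e : ω.gallery (V.single (V.panelInv g) (V.not_isTrivial_panelInv hg)) =
      W.single (W.panelInv (ω.hom g)) (W.not_isTrivial_panelInv (ω.nontrivial g hg)) :=
      single_congr (ω.hom_inv g) (ω.nontrivial _ (V.not_isTrivial_panelInv hg)) _
    rw [e]
    exact h
  | shortcut g k hg hk hgk =>
    have hn : ¬ W.IsTrivial (W.panelComp (ω.hom g) (ω.hom k)) := by
      rw [← ω.hom_comp]; exact ω.nontrivial _ hgk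
    have h := Homotopic.of_move (Move.shortcut (W := W) (ω.hom g) (ω.hom k) (ω.nontrivial g hg)
      (ω.nontrivial k hk) hn)
    rw [ω.gallery_comp]
    have e : ω.gallery (V.single (V.panelComp g k) hgk) =
      W.single (W.panelComp (ω.hom g) (ω.hom k)) hn :=
      single_congr (ω.hom_comp g k) (ω.nontrivial _ hgk) _
    rw [e]
    exact h
  | suite θ hθ => exact ω.suite _ _ _ θ hθ

theorem homotopic (ω : Morphism f V W) {x y : V.Chamber} {β γ : V.Gallery x y}
    (h : V.Homotopic β γ) : W.Homotopic (ω.gallery β) (ω.gallery γ) := by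
  induction h with
  | rel β γ h =>
    obtain ⟨p, c, d, q, h⟩ := h
    rw [ω.gallery_comp, ω.gallery_comp, ω.gallery_comp, ω.gallery_comp]
    exact (ω.move h).whisker _ _
  | refl β => exact Homotopic.refl _
  | symm β γ _ ih => exact ih.symm
  | trans β γ δ _ _ ih ih' => exact ih.trans ih'

/-- The homomorphism of fundamental groupoids `[β] ↦ [ω ∘ β]` induced by a morphism `ω`. -/
def induced (ω : Morphism f V W) : V.FundamentalGroupoid ⥤ W.FundamentalGroupoid where
  obj x := ω.chamber x
  map {x y} a := Quotient.map (sa := V.homotopySetoid x y)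
    (sb := W.homotopySetoid (ω.chamber x) (ω.chamber y)) (fun β => ω.gallery β)
    (fun _ _ h => ω.homotopic h) a
  map_id _ := rfl
  map_comp a b := by
    induction a using Quotient.inductionOn with
    | h β => induction b using Quotient.inductionOn with
      | h γ => exact congrArg (Quotient.mk _) (ω.gallery_comp β γ)

end Morphism

/-! ### Restrictions and residues -/

section
variable {S : Type u₃} {M : CoxeterMatrix S} (W : WeylData.{u, v} M)

/-- The `J`-restriction: its defining suites are the defining `(s,t)`-suites of `W` with
`s, t ∈ J`. -/
def restrict (J : Set S) : WeylData.{u, v} (M.restrict J) where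
  toGeneralizedChamberSystem := W.toGeneralizedChamberSystem.restrict J
  defSuite s t x :=
    {θ | (W.toGeneralizedChamberSystem.restrictInclusion J).gallery θ ∈ W.defSuite s t x}
  defSuite_spec := by
    intro s t x θ hθ
    obtain ⟨h₁, h₂, h₃⟩ := W.defSuite_spec _ _ _ _ hθ
    refine ⟨fun h => h₁ (congrArg _ h), h₂, ?_⟩
    apply List.map_injective_iff.mpr (Subtype.val_injective (p := (· ∈ J)))
    rw [altWord_map]
    exact ((W.toGeneralizedChamberSystem.restrictInclusion J).types_gallery θ).symm.trans h₃

/-- The internal embedding of the `J`-restriction. -/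
def internal (J : Set S) : Morphism (Subtype.val : J → S) (W.restrict J) W where
  toMorphism := W.toGeneralizedChamberSystem.restrictInclusion J
  suite _ _ _ _ hθ := Homotopic.of_move (Move.suite _ hθ)

/-- The Weyl data with the same generalized chamber system as `W` which has all the suites of `W`
as defining suites. -/
def saturation : WeylData.{u, v} M where
  toGeneralizedChamberSystem := W.toGeneralizedChamberSystem
  defSuite s t x := {θ | W.IsSuite s t θ}
  defSuite_spec := fun _ _ _ _ hθ => ⟨hθ.1, hθ.2.1, hθ.2.2.1⟩

/-- The internal embedding of the `J`-restriction of `W.saturation`, which is the `J`-restriction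
of `W` whose defining suites are all the `(s,t)`-suites of `W` with `s, t ∈ J`. -/
def saturatedInternal (J : Set S) :
    Morphism (Subtype.val : J → S) (W.saturation.restrict J) W where
  toMorphism := W.toGeneralizedChamberSystem.restrictInclusion J
  suite _ _ _ _ hθ := hθ.2.2.2

/-- The full subdata on a set of chambers. -/
def full (X : Set W.Chamber) : WeylData.{u, v} M where
  toGeneralizedChamberSystem := W.toGeneralizedChamberSystem.full X
  defSuite s t x :=
    {θ | (W.toGeneralizedChamberSystem.fullInclusion X).gallery θ ∈ W.defSuite s t x.1}
  defSuite_spec := by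
    intro s t x θ hθ
    obtain ⟨h₁, h₂, h₃⟩ := W.defSuite_spec _ _ _ _ hθ
    refine ⟨h₁, h₂, ?_⟩
    have h := (W.toGeneralizedChamberSystem.fullInclusion X).types_gallery θ
    rw [List.map_id] at h
    exact h.symm.trans h₃

/-- The connected component of the chamber `C`. -/
def component (C : W.Chamber) : WeylData.{u, v} M :=
  W.full {D | Nonempty (W.Gallery C D)}

/-- The gallery of `W` given by a gallery of the `J`-residue at `C`, which is the connected
component of `C` in the `J`-restriction. -/
def ofResidue (J : Set S) (C : (W.restrict J).Chamber)
    {x y : ((W.restrict J).component C).Chamber}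
    (β : ((W.restrict J).component C).Gallery x y) : W.Gallery x.1 y.1 :=
  (W.toGeneralizedChamberSystem.restrictInclusion J).gallery
    (((W.restrict J).toGeneralizedChamberSystem.fullInclusion _).gallery β)

end

end WeylData

/-- A homomorphism of groupoids is an embedding if it is injective on the set of all edges. -/
def IsGroupoidEmbedding {G : Type*} {H : Type*} [Groupoid G] [Groupoid H] (F : G ⥤ H) : Prop :=
  Function.Injective (fun e : (Σ x : G, Σ y : G, (x ⟶ y)) =>
    (⟨F.obj e.1, F.obj e.2.1, F.map e.2.2⟩ : Σ x : H, Σ y : H, (x ⟶ y)))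

/-!
In a Weyl datum with (PW1) every gallery is homotopic to a geodesic: by Matsumoto's theorem a
non-reduced word can be turned by braid moves into one with two equal adjacent letters, (PW1)
realises braid moves by homotopies, and two consecutive edges of the same type can be shortened in
their panel. Now let `J ⊆ S`, suppose that the `J`-restriction has (PW1), and let `β`, `γ` be
galleries of it which are homotopic in `W`. Then `βγ⁻¹` is homotopic in the restriction to a closed
geodesic. Its type is also reduced over `S`, since a braid move over `S` applied to a word in `J`
stays in `J`; its `W`-length is trivial by (W); so it is empty. With saturated defining suites
(PW1) passes to the restriction, since a maximal geodesic followed by the inverse of a homotopic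
one is a suite.
-/

/-! ### Dihedral rotations and the geometric representation -/

namespace Coxeter

section DihedralRotation

variable {V : Type*} [AddCommGroup V] [Module ℝ V] {x y : V} {f g : Module.Dual ℝ V} {θ : ℝ}

theorem sin_smul_reflection_mul_reflection_pow_apply_self (hf : f x = 2) (hg : g y = 2)
    (hfy : f y = -2 * Real.cos θ) (hgx : g x = -2 * Real.cos θ) (k : ℕ) :
    Real.sin θ • ((Module.reflection hf * Module.reflection hg) ^ k) x =
      Real.sin ((2 * k + 1) * θ) • x + Real.sin (2 * k * θ) • y := by
  induction k with
  | zero => simp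
  | succ k ih =>
    have hy : Real.sin (2 * ((k + 1 : ℕ) : ℝ) * θ) =
        2 * Real.cos θ * Real.sin ((2 * k + 1) * θ) - Real.sin (2 * k * θ) := by
      rw [show 2 * ((k + 1 : ℕ) : ℝ) * θ = (2 * k + 1) * θ + θ by push_cast; ring,
        show 2 * (k : ℝ) * θ = (2 * k + 1) * θ - θ by ring, Real.sin_add, Real.sin_sub]
      ring
    have hx : Real.sin ((2 * ((k + 1 : ℕ) : ℝ) + 1) * θ) =
        2 * Real.cos θ * Real.sin (2 * ((k + 1 : ℕ) : ℝ) * θ) - Real.sin ((2 * k + 1) * θ) := by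
      rw [show (2 * ((k + 1 : ℕ) : ℝ) + 1) * θ = 2 * ((k + 1 : ℕ) : ℝ) * θ + θ by ring,
        show (2 * (k : ℝ) + 1) * θ = 2 * ((k + 1 : ℕ) : ℝ) * θ - θ by push_cast; ring,
        Real.sin_add, Real.sin_sub]
      ring
    rw [hx, hy, pow_succ', LinearEquiv.mul_apply, ← map_smul, ih]
    simp only [LinearEquiv.mul_apply, Module.reflection_apply, map_add, map_sub, map_smul,
      hf, hg, hfy, hgx]
    module

theorem reflection_mul_reflection_pow_apply_self_eq_self (hf : f x = 2) (hg : g y = 2)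
    (hfy : f y = -2 * Real.cos θ) (hgx : g x = -2 * Real.cos θ) (hθ : Real.sin θ ≠ 0) {k : ℕ}
    (hk : Real.cos (2 * k * θ) = 1) :
    ((Module.reflection hf * Module.reflection hg) ^ k) x = x := by
  have h := sin_smul_reflection_mul_reflection_pow_apply_self hf hg hfy hgx k
  have hk' : Real.sin (2 * k * θ) = 0 := Real.sin_eq_zero_iff_cos_eq.mpr (.inl hk)
  rw [add_mul, one_mul, Real.sin_add, hk, hk'] at h
  exact smul_right_injective V hθ (by simpa using h)

theorem reflection_mul_reflection_pow_eq_one (hf : f x = 2) (hg : g y = 2)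
    (hfy : f y = -2 * Real.cos θ) (hgx : g x = -2 * Real.cos θ) (hθ : Real.sin θ ≠ 0) {k : ℕ}
    (hk : Real.cos (2 * k * θ) = 1) :
    (Module.reflection hf * Module.reflection hg) ^ k = 1 := by
  set P := Module.reflection hf * Module.reflection hg with hP
  have hx : (P ^ k) x = x :=
    reflection_mul_reflection_pow_apply_self_eq_self hf hg hfy hgx hθ hk
  have hy : (P ^ k) y = y := by
    have hPinv : P⁻¹ = Module.reflection hg * Module.reflection hf := by
      simp [hP, mul_inv_rev]
    suffices (P⁻¹ ^ k) y = y by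
      rw [inv_pow] at this
      exact ((LinearEquiv.symm_apply_eq _).mp this).symm
    rw [hPinv]
    exact reflection_mul_reflection_pow_apply_self_eq_self hg hf hgx hfy hθ hk
  have hfix : ∀ z, f z = 0 → g z = 0 → (P ^ k) z = z := by
    intro z hfz hgz
    have hz : P z = z := by simp [hP, LinearEquiv.mul_apply, Module.reflection_apply, hfz, hgz]
    rw [LinearEquiv.coe_pow]
    exact Function.iterate_fixed hz k
  have hdet : 1 - Real.cos θ ^ 2 ≠ 0 := by
    rw [← Real.sin_sq]; exact pow_ne_zero 2 hθ
  ext z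
  -- `x`, `y` and the common kernel of `f` and `g` span, as the Gram determinant is `4 sin² θ ≠ 0`.
  set a := (f z + Real.cos θ * g z) / (2 * (1 - Real.cos θ ^ 2)) with ha
  set b := (g z + Real.cos θ * f z) / (2 * (1 - Real.cos θ ^ 2)) with hb
  have hw := hfix (z - a • x - b • y)
    (by simp only [map_sub, map_smul, smul_eq_mul, hf, hfy, ha, hb]; field_simp; ring)
    (by simp only [map_sub, map_smul, smul_eq_mul, hg, hgx, ha, hb]; field_simp; ring)
  simpa [map_sub, map_smul, hx, hy] using hw

theorem cos_eq_one_of_reflection_mul_reflection_pow_eq_one (hf : f x = 2) (hg : g y = 2)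
    (hfy : f y = -2 * Real.cos θ) (hgx : g x = -2 * Real.cos θ) (hθ : Real.sin θ ≠ 0)
    (hxy : LinearIndependent ℝ ![x, y]) {k : ℕ}
    (hk : (Module.reflection hf * Module.reflection hg) ^ k = 1) : Real.cos (2 * k * θ) = 1 := by
  have h := sin_smul_reflection_mul_reflection_pow_apply_self hf hg hfy hgx k
  rw [hk, LinearEquiv.coe_one, id_eq] at h
  obtain ⟨hx, hy⟩ := LinearIndependent.pair_iff.mp hxy (Real.sin ((2 * k + 1) * θ) - Real.sin θ)
    (Real.sin (2 * k * θ)) (by rw [sub_smul, h]; module)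
  rw [add_mul, one_mul, Real.sin_add, hy, zero_mul, zero_add, sub_eq_zero] at hx
  exact (mul_eq_right₀ hθ).mp hx

theorem eq_zero_of_reflection_mul_reflection_pow_eq_one (hf : f x = 2) (hg : g y = 2)
    (hfg : f y * g x = 4) (hxy : LinearIndependent ℝ ![x, y]) {k : ℕ}
    (hk : (Module.reflection hf * Module.reflection hg) ^ k = 1) : k = 0 := by
  have h := Module.reflection_mul_reflection_pow_apply_self hf hg k 2 (by linarith)
  rw [hk, LinearEquiv.coe_one, id_eq, Polynomial.Chebyshev.S_eval_two,
    Polynomial.Chebyshev.S_eval_two] at h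
  obtain ⟨-, hy⟩ := LinearIndependent.pair_iff.mp hxy _ _
    (show (2 * k : ℝ) • x + (k * -g x) • y = 0 by
      push_cast at h
      rw [← sub_eq_zero.mpr h.symm]
      module)
  have : g x ≠ 0 := right_ne_zero_of_mul (hfg.trans_ne four_ne_zero)
  simpa [this] using hy

end DihedralRotation

section GeometricRepresentation

variable {B : Type*} (M : CoxeterMatrix B)

/-- The linear form `j ↦ 2⟨eᵢ, eⱼ⟩ = -2 cos (π / mᵢⱼ)` on the free vector space on `B`, where
`⟨·, ·⟩` is Tits' bilinear form. The entry `0` stands for `∞`, and indeed `cos (π / 0) = 1`. -/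
noncomputable def geometricCoroot (i : B) : Module.Dual ℝ (B →₀ ℝ) :=
  Finsupp.linearCombination ℝ fun j => -2 * Real.cos (Real.pi / M i j)

@[simp] theorem geometricCoroot_single (i j : B) :
    geometricCoroot M i (Finsupp.single j 1) = -2 * Real.cos (Real.pi / M i j) := by
  simp [geometricCoroot]

theorem geometricCoroot_single_self (i : B) : geometricCoroot M i (Finsupp.single i 1) = 2 := by
  simp

/-- The image of the simple reflection `i` in the geometric (Tits) representation. -/
noncomputable def geometricReflection (i : B) : (B →₀ ℝ) ≃ₗ[ℝ] (B →₀ ℝ) :=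
  Module.reflection (geometricCoroot_single_self M i)

theorem cos_two_mul_mul_pi_div_eq_one_iff {m k : ℕ} (hm : m ≠ 0) :
    Real.cos (2 * k * (Real.pi / m)) = 1 ↔ m ∣ k := by
  rw [Real.cos_eq_one_iff]
  constructor
  · rintro ⟨n, hn⟩
    have : (n * m : ℝ) = k := by
      field_simp at hn
      linarith
    exact Int.natCast_dvd_natCast.mp ⟨n, by exact_mod_cast (this.symm.trans (mul_comm _ _))⟩
  · rintro ⟨n, rfl⟩
    exact ⟨n, by push_cast; field_simp⟩

theorem geometricReflection_mul_pow_eq_one_iff (i j : B) (k : ℕ) :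
    (geometricReflection M i * geometricReflection M j) ^ k = 1 ↔ M i j ∣ k := by
  obtain rfl | hij := eq_or_ne i j
  · have hsq : geometricReflection M i * geometricReflection M i = 1 :=
      LinearEquiv.ext (Module.involutive_reflection (geometricCoroot_single_self M i))
    simp [hsq]
  have hli : LinearIndependent ℝ ![Finsupp.single i (1 : ℝ), Finsupp.single j 1] := by
    have h := (Finsupp.linearIndependent_single_one ℝ B).comp ![i, j] (by
      simpa [Function.Injective, Fin.forall_fin_two, eq_comm] using hij)
    convert h using 1
    ext k : 1
    fin_cases k <;> rfl
  obtain hM | hM := eq_or_ne (M i j) 0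
  · rw [hM, zero_dvd_iff]
    refine ⟨eq_zero_of_reflection_mul_reflection_pow_eq_one _ _ ?_ hli, by rintro rfl; simp⟩
    norm_num [hM, M.symmetric j i]
  · have hsin : Real.sin (Real.pi / M i j) ≠ 0 := by
      have hM₂ : (2 : ℝ) ≤ M i j := by
        exact_mod_cast (by have := M.off_diagonal i j hij; omega : 2 ≤ M i j)
      exact (Real.sin_pos_of_pos_of_lt_pi (by positivity)
        (div_lt_self Real.pi_pos (by linarith))).ne'
    have hi := geometricCoroot_single M i j
    have hj := M.symmetric i j ▸ geometricCoroot_single M j i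
    rw [← cos_two_mul_mul_pi_div_eq_one_iff hM]
    exact ⟨cos_eq_one_of_reflection_mul_reflection_pow_eq_one _ _ hi hj hsin hli,
      reflection_mul_reflection_pow_eq_one _ _ hi hj hsin⟩

theorem orderOf_simple_mul_simple {G : Type*} [Group G] {M : CoxeterMatrix B}
    (cs : CoxeterSystem M G) (i j : B) : orderOf (cs.simple i * cs.simple j) = M i j := by
  have hlift : M.IsLiftable (geometricReflection M) := fun i j =>
    (geometricReflection_mul_pow_eq_one_iff M i j _).mpr dvd_rfl
  refine Nat.dvd_antisymm (orderOf_dvd_of_pow_eq_one (cs.simple_mul_simple_pow i j)) ?_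
  rw [← geometricReflection_mul_pow_eq_one_iff]
  simpa only [map_pow, map_mul, map_one, cs.lift_apply_simple] using
    congrArg (cs.lift ⟨geometricReflection M, hlift⟩)
      (pow_orderOf_eq_one (cs.simple i * cs.simple j))

end GeometricRepresentation

/-! ### Alternating words -/

section AlternatingWord

variable {B : Type*} (s t : B)

theorem length_altWord (m : ℕ) : (altWord s t m).length = m := by
  induction m generalizing s t with
  | zero => rfl
  | succ m ih => simp [altWord, ih]

theorem altWord_two_mul_concat (m : ℕ) : altWord s t (2 * m) ++ [s] = altWord s t (2 * m + 1) := by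
  induction m with
  | zero => rfl
  | succ m ih => exact congrArg (s :: t :: ·) ih

theorem altWord_append_reverse (m : ℕ) :
    altWord s t m ++ (altWord t s m).reverse = altWord s t (2 * m) := by
  induction m generalizing s t with
  | zero => rfl
  | succ m ih =>
    rw [altWord, altWord, List.reverse_cons, List.cons_append, ← List.append_assoc, ih,
      altWord_two_mul_concat]
    rfl

theorem reverse_altWord_two_mul (m : ℕ) :
    (altWord s t (2 * m)).reverse = altWord t s (2 * m) := by
  rw [← altWord_append_reverse, List.reverse_append, List.reverse_reverse, altWord_append_reverse]

theorem prod_map_altWord_two_mul {N : Type*} [Monoid N] (f : B → N) (m : ℕ) :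
    ((altWord s t (2 * m)).map f).prod = (f s * f t) ^ m := by
  induction m with
  | zero => simp [altWord]
  | succ m ih => rw [pow_succ', ← ih, mul_assoc, ← List.prod_cons, ← List.prod_cons]; rfl

variable {s t}

theorem left_mem_altWord {m : ℕ} (hm : 1 ≤ m) : s ∈ altWord s t m := by
  obtain ⟨m, rfl⟩ := Nat.exists_eq_add_of_le' hm
  exact List.mem_cons_self

theorem right_mem_altWord {m : ℕ} (hm : 2 ≤ m) : t ∈ altWord s t m := by
  obtain ⟨m, rfl⟩ := Nat.exists_eq_add_of_le' hm
  exact List.mem_cons_of_mem _ List.mem_cons_self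

end AlternatingWord

/-! ### The exchange condition -/

section Exchange

variable {B : Type*} {M : CoxeterMatrix B} {G : Type*} [Group G] (cs : CoxeterSystem M G)

theorem wordProd_altWord_eq (s t : B) :
    cs.wordProd (altWord s t (M s t)) = cs.wordProd (altWord t s (M s t)) := by
  rw [← mul_inv_eq_one, ← cs.wordProd_reverse, ← cs.wordProd_append, altWord_append_reverse]
  exact (prod_map_altWord_two_mul s t cs.simple _).trans (cs.simple_mul_simple_pow s t)

theorem leftInvSeq_append (ω ω' : List B) : cs.leftInvSeq (ω ++ ω') =
    cs.leftInvSeq ω ++ (cs.leftInvSeq ω').map (MulAut.conj (cs.wordProd ω)) := by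
  induction ω with
  | nil => simp
  | cons i ω ih =>
    simp [CoxeterSystem.leftInvSeq, ih, cs.wordProd_cons, List.map_append, Function.comp_def,
      mul_assoc]

theorem leftInvSeq_altWord (s t : B) (m : ℕ) : cs.leftInvSeq (altWord s t m) =
    (List.range m).map fun k => (cs.simple s * cs.simple t) ^ k * cs.simple s := by
  induction m generalizing s t with
  | zero => rfl
  | succ m ih =>
    rw [altWord, CoxeterSystem.leftInvSeq, ih, List.range_succ_eq_map, List.map_cons, pow_zero,
      one_mul, List.map_map, List.map_map]
    congr 2
    ext k
    simp only [Function.comp_apply, MulAut.conj_apply, cs.inv_simple, pow_succ]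
    rw [← mul_assoc, (SemiconjBy.pow_right (y := cs.simple s * cs.simple t)
      (by simp [SemiconjBy, mul_assoc]) k : SemiconjBy (cs.simple s) _ _).eq]
    simp only [mul_assoc]

theorem even_count_leftInvSeq_altWord [DecidableEq G] (s t : B) (g : G) :
    Even ((cs.leftInvSeq (altWord s t (2 * M s t))).count g) := by
  rw [leftInvSeq_altWord, two_mul, List.range_add, List.map_append, List.map_map, List.count_append]
  simp only [Function.comp_def, pow_add, cs.simple_mul_simple_pow, one_mul]
  exact ⟨_, rfl⟩

open Classical in
/-- The involution of `G × ZMod 2` attached to a simple reflection `s`: it conjugates the first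
component by `s` and changes the second one exactly if the first one is `s`. -/
noncomputable def signPerm (i : B) : Equiv.Perm (G × ZMod 2) :=
  Function.Involutive.toPerm
    (fun p => (cs.simple i * p.1 * cs.simple i, p.2 + if p.1 = cs.simple i then 1 else 0)) <| by
      rintro ⟨g, a⟩
      have hg : cs.simple i * g * cs.simple i = cs.simple i ↔ g = cs.simple i := by
        rw [mul_eq_right, mul_eq_one_iff_eq_inv', cs.inv_simple]
      ext
      · simp [mul_assoc]
      · simp only [hg, add_assoc, CharTwo.add_self_eq_zero, add_zero]

open Classical in
theorem signPerm_apply (i : B) (p : G × ZMod 2) : signPerm cs i p =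
    (cs.simple i * p.1 * cs.simple i, p.2 + if p.1 = cs.simple i then 1 else 0) := rfl

open Classical in
theorem prod_map_signPerm_apply (ω : List B) (p : G × ZMod 2) :
    (ω.map (signPerm cs)).prod p = (cs.wordProd ω * p.1 * (cs.wordProd ω)⁻¹,
      p.2 + ((cs.rightInvSeq ω).count p.1 : ZMod 2)) := by
  induction ω with
  | nil => simp
  | cons i ω ih =>
    have hi : cs.wordProd ω * p.1 * (cs.wordProd ω)⁻¹ = cs.simple i ↔
        (cs.wordProd ω)⁻¹ * cs.simple i * cs.wordProd ω = p.1 := by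
      rw [mul_inv_eq_iff_eq_mul, ← eq_inv_mul_iff_mul_eq, ← mul_assoc, eq_comm]
    rw [List.map_cons, List.prod_cons, Equiv.Perm.mul_apply, ih, signPerm_apply]
    ext
    · simp [cs.wordProd_cons, mul_assoc]
    · simp [hi, CoxeterSystem.rightInvSeq, List.count_cons, add_assoc]

theorem signPerm_isLiftable : M.IsLiftable (signPerm cs) := by
  classical
  intro s t
  rw [← prod_map_altWord_two_mul]
  ext1 p
  have hπ : cs.wordProd (altWord s t (2 * M s t)) = 1 :=
    (prod_map_altWord_two_mul s t cs.simple _).trans (cs.simple_mul_simple_pow s t)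
  have heven := even_count_leftInvSeq_altWord cs t s p.1
  rw [M.symmetric t s, ← List.count_reverse, ← cs.rightInvSeq_reverse, reverse_altWord_two_mul]
    at heven
  simp [prod_map_signPerm_apply, hπ, (ZMod.natCast_eq_zero_iff_even).mpr heven]

theorem count_rightInvSeq_congr [DecidableEq G] {ω ω' : List B}
    (h : cs.wordProd ω = cs.wordProd ω') (g : G) :
    ((cs.rightInvSeq ω).count g : ZMod 2) = (cs.rightInvSeq ω').count g := by
  have hlift (ω : List B) :
      (ω.map (signPerm cs)).prod = cs.lift ⟨_, signPerm_isLiftable cs⟩ (cs.wordProd ω) := by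
    simp [CoxeterSystem.wordProd, map_list_prod, Function.comp_def]
  have hω := congrArg (fun σ : Equiv.Perm (G × ZMod 2) => (σ (g, 0)).2)
    ((hlift ω).trans ((congrArg _ h).trans (hlift ω').symm))
  simp only [prod_map_signPerm_apply, zero_add] at hω
  convert hω

theorem simple_mem_rightInvSeq_of_isRightDescent {ω : List B} {i : B}
    (h : cs.IsRightDescent (cs.wordProd ω) i) : cs.simple i ∈ cs.rightInvSeq ω := by
  classical
  obtain ⟨ω', hω', hw'⟩ := cs.exists_isReduced (cs.wordProd ω * cs.simple i)
  have hw : cs.wordProd (ω'.concat i) = cs.wordProd ω := by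
    rw [List.concat_eq_append, cs.wordProd_append, ← hw']
    simp
  have hred : cs.IsReduced (ω'.concat i) := by
    rw [cs.isRightDescent_iff] at h
    rw [CoxeterSystem.IsReduced, hw, ← h, hw', hω'.eq, List.length_concat]
  have hmem : cs.simple i ∈ cs.rightInvSeq (ω'.concat i) := by
    rw [cs.rightInvSeq_concat]
    simp
  have hcount := count_rightInvSeq_congr cs hw (cs.simple i)
  rw [List.count_eq_one_of_mem hred.nodup_rightInvSeq hmem] at hcount
  by_contra hn
  simp [List.count_eq_zero_of_not_mem hn] at hcount

theorem simple_mem_leftInvSeq_of_isLeftDescent {ω : List B} {i : B}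
    (h : cs.IsLeftDescent (cs.wordProd ω) i) : cs.simple i ∈ cs.leftInvSeq ω := by
  rw [← cs.isRightDescent_inv_iff, ← cs.wordProd_reverse] at h
  simpa [cs.rightInvSeq_reverse] using simple_mem_rightInvSeq_of_isRightDescent cs h

theorem exists_mul_wordProd_eq_eraseIdx {ω : List B} {r : G} (hr : r ∈ cs.leftInvSeq ω) :
    ∃ j < ω.length, r * cs.wordProd ω = cs.wordProd (ω.eraseIdx j) := by
  obtain ⟨j, hj, rfl⟩ := List.mem_iff_getElem.mp hr
  exact ⟨j, by simpa using hj,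
    by rw [← cs.getD_leftInvSeq_mul_wordProd, List.getD_eq_getElem _ _ hj]⟩

end Exchange

/-! ### Braid moves -/

section BraidMove

variable {B : Type*}

/-- A braid move replaces a subword `s t s ⋯` of length `m_{st} < ∞` by `t s t ⋯`, where `s ≠ t`.
(An entry `0` of a Coxeter matrix stands for `∞`.) -/
inductive BraidMove (M : CoxeterMatrix B) : List B → List B → Prop
  | mk (a b : List B) {s t : B} (hst : s ≠ t) (hM : M s t ≠ 0) :
      BraidMove M (a ++ (altWord s t (M s t) ++ b)) (a ++ (altWord t s (M s t) ++ b))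

/-- Two words are braid equivalent if a sequence of braid moves leads from the first one to the
second one. (This is a symmetric relation, since the inverse of a braid move is a braid move.) -/
def BraidEquiv (M : CoxeterMatrix B) : List B → List B → Prop :=
  Relation.ReflTransGen (BraidMove M)

variable {M : CoxeterMatrix B} {ω ω' : List B}

theorem BraidMove.cons (h : BraidMove M ω ω') (i : B) : BraidMove M (i :: ω) (i :: ω') := by
  obtain ⟨a, b, hst, hM⟩ := h
  exact .mk (i :: a) b hst hM

theorem BraidEquiv.cons (h : BraidEquiv M ω ω') (i : B) : BraidEquiv M (i :: ω) (i :: ω') :=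
  Relation.ReflTransGen.lift (i :: ·) (fun _ _ h => h.cons i) _ _ h

theorem BraidMove.length_eq (h : BraidMove M ω ω') : ω.length = ω'.length := by
  obtain ⟨a, b, -, -⟩ := h
  simp [length_altWord]

theorem BraidEquiv.length_eq (h : BraidEquiv M ω ω') : ω.length = ω'.length := by
  induction h with
  | refl => rfl
  | tail _ h ih => rw [ih, h.length_eq]

variable {G : Type*} [Group G] (cs : CoxeterSystem M G)

theorem BraidMove.wordProd_eq (h : BraidMove M ω ω') : cs.wordProd ω = cs.wordProd ω' := by
  obtain @⟨a, b, s, t, -, -⟩ := h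
  simp only [cs.wordProd_append, wordProd_altWord_eq cs s t]

theorem BraidEquiv.isReduced_iff (h : BraidEquiv M ω ω') :
    cs.IsReduced ω ↔ cs.IsReduced ω' := by
  induction h with
  | refl => rfl
  | tail _ h ih =>
    rw [ih, CoxeterSystem.IsReduced, CoxeterSystem.IsReduced, h.wordProd_eq cs, h.length_eq]

end BraidMove

/-! ### The theorems of Matsumoto and Tits -/

section Matsumoto

variable {B : Type*} {M : CoxeterMatrix B} {G : Type*} [Group G] (cs : CoxeterSystem M G)

theorem isReduced_of_wordProd_eq {ω ω' : List B} (hω : cs.IsReduced ω)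
    (hprod : cs.wordProd ω' = cs.wordProd ω) (hlen : ω'.length = ω.length) :
    cs.IsReduced ω' := by
  rw [CoxeterSystem.IsReduced, hprod, hω.eq, hlen]

theorem simple_notMem_leftInvSeq_altWord {s t : B} {m : ℕ} (hm : M s t = 0 ∨ m < M s t) :
    cs.simple s ∉ cs.leftInvSeq (altWord t s m) := by
  rw [leftInvSeq_altWord, List.mem_map]
  rintro ⟨k, hk, hks⟩
  have hpow : (cs.simple t * cs.simple s) ^ (k + 1) = 1 := by
    rw [pow_succ, ← mul_assoc, hks, cs.simple_mul_simple_self]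
  have hdvd := orderOf_dvd_of_pow_eq_one hpow
  rw [orderOf_simple_mul_simple, M.symmetric] at hdvd
  rw [List.mem_range] at hk
  rcases hm with hm | hm
  · simp [hm] at hdvd
  · exact absurd (Nat.le_of_dvd k.succ_pos hdvd) (by omega)

theorem exists_isReduced_altWord_append {w : G} {s t : B} (hs : cs.IsLeftDescent w s)
    (ht : cs.IsLeftDescent w t) {m : ℕ} (hm : M s t = 0 ∨ m ≤ M s t) :
    ∃ u, cs.wordProd (altWord s t m ++ u) = w ∧ cs.IsReduced (altWord s t m ++ u) := by
  induction m generalizing s t with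
  | zero =>
    obtain ⟨u, hu, hw⟩ := cs.exists_isReduced w
    exact ⟨u, hw.symm, hu⟩
  | succ m ih =>
    obtain ⟨u, rfl, hu⟩ := ih ht hs (by rw [M.symmetric]; omega)
    have hmem := simple_mem_leftInvSeq_of_isLeftDescent cs hs
    rw [leftInvSeq_append, List.mem_append] at hmem
    obtain ⟨r, hr, hrs⟩ := List.mem_map.mp <| hmem.resolve_left <|
      simple_notMem_leftInvSeq_altWord cs (hm.imp_right Nat.lt_of_succ_le)
    obtain ⟨j, hj, hju⟩ := exists_mul_wordProd_eq_eraseIdx cs hr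
    have hprod : cs.wordProd (altWord s t (m + 1) ++ u.eraseIdx j) =
        cs.wordProd (altWord t s m ++ u) := by
      have hsA : cs.simple s * cs.wordProd (altWord t s m) = cs.wordProd (altWord t s m) * r := by
        rw [← hrs, MulAut.conj_apply, inv_mul_cancel_right]
      rw [altWord, List.cons_append, cs.wordProd_cons, cs.wordProd_append, cs.wordProd_append,
        ← hju, ← mul_assoc (cs.wordProd _), ← hsA, mul_assoc, cs.simple_mul_simple_cancel_left]
    refine ⟨u.eraseIdx j, hprod, isReduced_of_wordProd_eq cs hu hprod ?_⟩
    simp only [List.length_append, length_altWord, List.length_eraseIdx_of_lt hj]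
    omega

theorem ne_zero_of_isLeftDescent {w : G} {s t : B} (hs : cs.IsLeftDescent w s)
    (ht : cs.IsLeftDescent w t) : M s t ≠ 0 := by
  intro hM
  obtain ⟨u, hw, hu⟩ :=
    exists_isReduced_altWord_append cs hs ht (m := cs.length w + 1) (Or.inl hM)
  have hlen := hu.eq
  rw [hw, List.length_append, length_altWord] at hlen
  omega

theorem isLeftDescent_of_isReduced_cons {i : B} {ω : List B} (h : cs.IsReduced (i :: ω)) :
    cs.IsLeftDescent (cs.wordProd (i :: ω)) i := by
  rw [CoxeterSystem.IsLeftDescent, h.eq, cs.wordProd_cons, cs.simple_mul_simple_cancel_left]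
  exact Nat.lt_succ_of_le (cs.length_wordProd_le ω)

theorem exists_braidMove_of_isLeftDescent {w : G} {s t : B} (hst : s ≠ t)
    (hs : cs.IsLeftDescent w s) (ht : cs.IsLeftDescent w t) :
    ∃ a b : List B, BraidMove M (s :: a) (t :: b) ∧ cs.wordProd (s :: a) = w ∧
      cs.IsReduced (s :: a) := by
  have hM : M s t ≠ 0 := ne_zero_of_isLeftDescent cs hs ht
  obtain ⟨u, hu, hur⟩ := exists_isReduced_altWord_append cs hs ht (m := M s t) (.inr le_rfl)
  have hmove : BraidMove M (altWord s t (M s t) ++ u) (altWord t s (M s t) ++ u) :=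
    .mk [] u hst hM
  obtain ⟨m, hm⟩ := Nat.exists_eq_succ_of_ne_zero hM
  rw [hm] at hu hur hmove
  exact ⟨_, _, hmove, hu, hur⟩

theorem braidEquiv_of_isReduced {ω ω' : List B} (hω : cs.IsReduced ω) (hω' : cs.IsReduced ω')
    (h : cs.wordProd ω = cs.wordProd ω') : BraidEquiv M ω ω' := by
  have hlen : ω'.length = ω.length := by rw [← hω'.eq, ← h, hω.eq]
  induction hn : ω.length generalizing ω ω' with
  | zero =>
    rw [hn] at hlen
    rw [List.eq_nil_of_length_eq_zero hn, List.eq_nil_of_length_eq_zero hlen]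
    exact .refl
  | succ n ih =>
    have of_cons {i : B} {a b : List B} (ha : cs.IsReduced (i :: a)) (hb : cs.IsReduced (i :: b))
        (hab : cs.wordProd (i :: a) = cs.wordProd (i :: b)) (hal : (i :: a).length = n + 1)
        (hbl : (i :: b).length = n + 1) : BraidEquiv M (i :: a) (i :: b) := by
      rw [cs.wordProd_cons, cs.wordProd_cons, mul_right_inj] at hab
      exact (ih (ha.drop 1) (hb.drop 1) hab (by simp_all) (by simpa using hal)).cons i
    rw [hn] at hlen
    obtain ⟨s, a, rfl⟩ := List.exists_cons_of_length_eq_add_one hn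
    obtain ⟨t, b, rfl⟩ := List.exists_cons_of_length_eq_add_one hlen
    obtain rfl | hst := eq_or_ne s t
    · exact of_cons hω hω' h hn hlen
    -- Compare with a third reduced expression, to which a braid move applies at the beginning.
    have hs := isLeftDescent_of_isReduced_cons cs hω
    have ht := h ▸ isLeftDescent_of_isReduced_cons cs hω'
    obtain ⟨c, d, hmove, hc, hcr⟩ := exists_braidMove_of_isLeftDescent cs hst hs ht
    have hdr := (BraidEquiv.isReduced_iff cs (.single hmove)).mp hcr
    have hd := (hmove.wordProd_eq cs).symm.trans hc
    have hcl : (s :: c).length = n + 1 := by rw [← hcr.eq, hc, hω.eq, hn]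
    have hdl : (t :: d).length = n + 1 := hmove.length_eq.symm.trans hcl
    exact ((of_cons hω hcr hc.symm hn hcl).tail hmove).trans
      (of_cons hdr hω' (hd.trans h) hdl hlen)

theorem exists_braidEquiv_of_not_isReduced {ω : List B} (hω : ¬ cs.IsReduced ω) :
    ∃ (a b : List B) (s : B), BraidEquiv M ω (a ++ s :: s :: b) := by
  induction ω with
  | nil => exact absurd (by simp [CoxeterSystem.IsReduced]) hω
  | cons i ω ih =>
    by_cases hω' : cs.IsReduced ω
    · have hi : cs.IsLeftDescent (cs.wordProd ω) i := by
        contrapose! hω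
        rw [cs.not_isLeftDescent_iff] at hω
        rw [CoxeterSystem.IsReduced, cs.wordProd_cons, hω, hω'.eq, List.length_cons]
      obtain ⟨u, hu, hur⟩ := exists_isReduced_altWord_append cs hi hi (m := 1) (by simp)
      exact ⟨[], u, i, (braidEquiv_of_isReduced cs hω' hur hu.symm).cons i⟩
    · obtain ⟨a, b, s, h⟩ := ih hω'
      exact ⟨i :: a, b, s, h.cons i⟩

end Matsumoto

/-! ### Parabolic subgroups -/

section Parabolic

variable {B : Type*} {M : CoxeterMatrix B} {J : Set B}

theorem BraidMove.exists_map_val_eq {ω : List J} {ζ : List B}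
    (h : BraidMove M (ω.map Subtype.val) ζ) :
    ∃ ω' : List J, ω'.map Subtype.val = ζ ∧ BraidMove (M.restrict J) ω ω' := by
  generalize hξ : ω.map Subtype.val = ξ at h
  obtain @⟨a, b, s, t, hst, hM⟩ := h
  obtain ⟨a, ω, rfl, rfl, hω⟩ := List.map_eq_append_iff.mp hξ
  obtain ⟨c, b, rfl, hc, rfl⟩ := List.map_eq_append_iff.mp hω
  have mem_J {i : B} (hi : i ∈ altWord s t (M s t)) : i ∈ J := by
    rw [← hc] at hi
    obtain ⟨j, -, rfl⟩ := List.mem_map.mp hi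
    exact j.2
  have hM₁ := M.off_diagonal s t hst
  lift s to J using mem_J (left_mem_altWord (by omega))
  lift t to J using mem_J (right_mem_altWord (by omega))
  rw [← altWord_map, List.map_inj_right Subtype.val_injective] at hc
  refine ⟨a ++ (altWord t s (M s t) ++ b), by simp [altWord_map], ?_⟩
  rw [hc]
  exact .mk a b (fun h => hst (congrArg _ h)) hM

theorem BraidEquiv.exists_map_val_eq {ω : List J} {ζ : List B}
    (h : BraidEquiv M (ω.map Subtype.val) ζ) :
    ∃ ω' : List J, ω'.map Subtype.val = ζ ∧ BraidEquiv (M.restrict J) ω ω' := by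
  induction h with
  | refl => exact ⟨ω, rfl, .refl⟩
  | tail _ hmove ih =>
    obtain ⟨ω', rfl, hω'⟩ := ih
    obtain ⟨ω'', rfl, hω''⟩ := hmove.exists_map_val_eq
    exact ⟨ω'', rfl, hω'.tail hω''⟩

theorem not_isReduced_append_cons_cons_self {G : Type*} [Group G] (cs : CoxeterSystem M G)
    (a b : List B) (s : B) : ¬ cs.IsReduced (a ++ s :: s :: b) := by
  intro h
  have hss : cs.IsReduced [s, s] := by simpa using (h.drop a.length).take 2
  simpa [cs.wordProd_cons] using hss.eq

theorem isReduced_map_val {G H : Type*} [Group G] [Group H] (cs : CoxeterSystem M G)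
    (csJ : CoxeterSystem (M.restrict J) H) {ω : List J} (hω : csJ.IsReduced ω) :
    cs.IsReduced (ω.map Subtype.val) := by
  by_contra hn
  obtain ⟨a, b, s, h⟩ := exists_braidEquiv_of_not_isReduced cs hn
  obtain ⟨ω', hω'_eq, hω'⟩ := h.exists_map_val_eq
  obtain ⟨a, ξ, rfl, -, hξ⟩ := List.map_eq_append_iff.mp hω'_eq
  obtain ⟨s₁, ξ, rfl, rfl, hξ⟩ := List.map_eq_cons_iff.mp hξ
  obtain ⟨s₂, b, rfl, hs, -⟩ := List.map_eq_cons_iff.mp hξ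
  obtain rfl := Subtype.val_injective hs
  exact not_isReduced_append_cons_cons_self csJ a b _ ((hω'.isReduced_iff csJ).mp hω)

end Parabolic

end Coxeter

/-! ### Galleries -/

namespace GeneralizedChamberSystem

namespace Gallery

variable {S : Type*} {W : GeneralizedChamberSystem.{u, v} S}

theorem types_cons {x y z : W.Chamber} (p : W.Gallery x y) (e : W.Edge y z) :
    types (Quiver.Path.cons p e) = types p ++ [e.type] := rfl

theorem types_comp {x y z : W.Chamber} (p : W.Gallery x y) (q : W.Gallery y z) :
    types (p.comp q) = types p ++ types q := by
  induction q with
  | nil => exact (List.append_nil _).symm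
  | cons q e ih => rw [Quiver.Path.comp_cons, types_cons, types_cons, ih, List.append_assoc]

theorem types_reverse {x y : W.Chamber} (p : W.Gallery x y) :
    types p.reverse = (types p).reverse := by
  induction p with
  | nil => rfl
  | cons p e ih =>
    rw [Quiver.Path.reverse, types_comp, ih, types_cons, List.reverse_append]
    rfl

theorem length_types {x y : W.Chamber} (p : W.Gallery x y) : (types p).length = p.length := by
  induction p with
  | nil => rfl
  | cons p e ih => rw [types_cons, List.length_append, ih]; rfl

theorem eq_nil_of_types_eq_nil {x : W.Chamber} {p : W.Gallery x x} (h : types p = []) :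
    p = Quiver.Path.nil :=
  Quiver.Path.eq_nil_of_length_zero p (by rw [← length_types, h, List.length_nil])

theorem exists_comp_of_types_eq_append {x y : W.Chamber} (p : W.Gallery x y) {a b : List S}
    (h : types p = a ++ b) : ∃ (z : W.Chamber) (q : W.Gallery x z) (r : W.Gallery z y),
      p = q.comp r ∧ types q = a ∧ types r = b := by
  induction p generalizing b with
  | nil =>
    obtain ⟨rfl, rfl⟩ := List.append_eq_nil_iff.mp h.symm
    exact ⟨_, Quiver.Path.nil, Quiver.Path.nil, rfl, rfl, rfl⟩
  | cons p e ih =>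
    obtain rfl | ⟨b, s, rfl⟩ := List.eq_nil_or_concat b
    · exact ⟨_, Quiver.Path.cons p e, Quiver.Path.nil, rfl, by simpa using h, rfl⟩
    · rw [types_cons, List.concat_eq_append, ← List.append_assoc] at h
      obtain ⟨hp, he⟩ := List.append_inj' h rfl
      obtain ⟨z, q, r, rfl, hq, hr⟩ := ih hp
      exact ⟨z, q, Quiver.Path.cons r e, rfl, hq,
        by rw [types_cons, hr, he, List.concat_eq_append]⟩

theorem exists_single_of_types_eq_singleton {x y : W.Chamber} (p : W.Gallery x y) {s : S}
    (h : types p = [s]) :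
    ∃ (g : W.PanelHom s x y) (hg : ¬ W.IsTrivial g), p = W.single g hg := by
  cases p with
  | nil => exact absurd h (List.cons_ne_nil s []).symm
  | cons p e =>
    obtain ⟨hp, he⟩ := List.append_inj' (t₁ := [e.type]) (s₂ := []) h rfl
    obtain ⟨t, g, hg⟩ := e
    obtain rfl : t = s := List.singleton_injective he
    have hlen : p.length = 0 := by rw [← length_types, hp, List.length_nil]
    obtain rfl := Quiver.Path.eq_of_length_zero p hlen
    obtain rfl := Quiver.Path.eq_nil_of_length_zero p hlen
    exact ⟨g, hg, rfl⟩

end Gallery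

theorem Morphism.gallery_reverse {S' S : Type*} {f : S' → S}
    {V : GeneralizedChamberSystem.{u₁, v₁} S'} {W : GeneralizedChamberSystem.{u, v} S}
    (ω : Morphism f V W) {x y : V.Chamber} (β : V.Gallery x y) :
    ω.gallery β.reverse = (ω.gallery β).reverse := by
  induction β with
  | nil => rfl
  | cons p e ih =>
    have he : ω.prefunctor.map (Quiver.reverse e) = Quiver.reverse (ω.prefunctor.map e) := by
      obtain ⟨s, g, hg⟩ := e
      change Edge.mk _ _ _ = Edge.mk _ _ _
      congr 1
      exact ω.hom_inv g
    rw [Quiver.Path.reverse, ω.gallery_comp, ih]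
    exact congrArg (fun e => Quiver.Path.comp (Quiver.Hom.toPath e) _) he

end GeneralizedChamberSystem

/-! ### Homotopies to geodesics -/

namespace WeylData

section Homotopy

variable {S : Type*} {M : CoxeterMatrix S} {W : WeylData.{u, v} M}

theorem homotopic_iff_nullHomotopic_comp_reverse {x y : W.Chamber} {β γ : W.Gallery x y} :
    W.Homotopic β γ ↔ W.NullHomotopic (β.comp γ.reverse) := by
  constructor
  · intro h
    exact (h.comp (.refl _)).trans (comp_reverse γ)
  · intro h
    have hβ := (Homotopic.refl β).comp (reverse_comp_self γ)
    have hγ := Homotopic.comp h (.refl γ)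
    simp only [Quiver.Path.nil_comp, Quiver.Path.comp_nil, Quiver.Path.comp_assoc] at hβ hγ
    exact hβ.symm.trans hγ

theorem exists_homotopic_single_comp_single {s : S} {x y z : W.Chamber} {g : W.PanelHom s x y}
    {h : W.PanelHom s y z} (hg : ¬ W.IsTrivial g) (hh : ¬ W.IsTrivial h) :
    ∃ β : W.Gallery x z, W.Homotopic (Quiver.Path.comp (W.single g hg) (W.single h hh)) β ∧
      (Gallery.types β).length < 2 := by
  by_cases hgh : W.IsTrivial (W.panelComp g h)
  · obtain ⟨rfl, hgh⟩ := hgh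
    obtain rfl : h = W.panelInv g := by
      rw [W.eq_panelInv (eq_of_heq hgh), W.panelInv_panelInv]
    exact ⟨Quiver.Path.nil, .of_move (.backtrack g hg), Nat.two_pos⟩
  · exact ⟨_, .of_move (.shortcut g h hg hh hgh), Nat.one_lt_two⟩

theorem exists_homotopic_length_lt_of_types_eq {x y : W.Chamber} (β : W.Gallery x y)
    {a b : List S} {s : S} (hβ : Gallery.types β = a ++ s :: s :: b) :
    ∃ γ : W.Gallery x y, W.Homotopic β γ ∧
      (Gallery.types γ).length < (Gallery.types β).length := by
  obtain ⟨_, p, r, rfl, hp, hr⟩ := Gallery.exists_comp_of_types_eq_append β hβ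
  obtain ⟨_, c, r, rfl, hc, hr⟩ := Gallery.exists_comp_of_types_eq_append (a := [s]) r hr
  obtain ⟨_, d, q, rfl, hd, hq⟩ := Gallery.exists_comp_of_types_eq_append (a := [s]) r hr
  obtain ⟨g, hg, rfl⟩ := Gallery.exists_single_of_types_eq_singleton c hc
  obtain ⟨h, hh, rfl⟩ := Gallery.exists_single_of_types_eq_singleton d hd
  obtain ⟨e, he, hlen⟩ := exists_homotopic_single_comp_single hg hh
  refine ⟨p.comp (e.comp q), by simpa only [Quiver.Path.comp_assoc] using he.whisker p q, ?_⟩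
  rw [hβ, Gallery.types_comp, Gallery.types_comp, hp, hq]
  simp only [List.length_append, List.length_cons]
  omega

theorem exists_homotopic_of_braidMove (hW : W.PW1) {x y : W.Chamber} (β : W.Gallery x y)
    {l : List S} (h : Coxeter.BraidMove M (Gallery.types β) l) :
    ∃ γ : W.Gallery x y, W.Homotopic β γ ∧ Gallery.types γ = l := by
  generalize hβ : Gallery.types β = l₀ at h
  obtain @⟨a, b, s, t, hst, hM⟩ := h
  obtain ⟨_, p, r, rfl, hp, hr⟩ := Gallery.exists_comp_of_types_eq_append β hβ
  obtain ⟨_, ρ, q, rfl, hρ, hq⟩ := Gallery.exists_comp_of_types_eq_append r hr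
  obtain ⟨ρ', ⟨-, -, hρ'⟩, hh⟩ := hW s t _ _ ρ ⟨hst, hM, hρ⟩
  refine ⟨p.comp (ρ'.comp q), hh.whisker p q, ?_⟩
  rw [Gallery.types_comp, Gallery.types_comp, hp, hq, hρ', M.symmetric]

theorem exists_homotopic_of_braidEquiv (hW : W.PW1) {x y : W.Chamber} (β : W.Gallery x y)
    {l : List S} (h : Coxeter.BraidEquiv M (Gallery.types β) l) :
    ∃ γ : W.Gallery x y, W.Homotopic β γ ∧ Gallery.types γ = l := by
  induction h with
  | refl => exact ⟨β, .refl β, rfl⟩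
  | tail _ hmove ih =>
    obtain ⟨γ, hγ, rfl⟩ := ih
    obtain ⟨δ, hδ, rfl⟩ := exists_homotopic_of_braidMove hW γ hmove
    exact ⟨δ, hγ.trans hδ, rfl⟩

theorem exists_isGeodesic_homotopic (hW : W.PW1) {x y : W.Chamber} (β : W.Gallery x y) :
    ∃ γ : W.Gallery x y, W.IsGeodesic γ ∧ W.Homotopic β γ := by
  induction hn : (Gallery.types β).length using Nat.strong_induction_on generalizing β with
  | _ n ih =>
    by_cases hβ : W.IsGeodesic β
    · exact ⟨β, hβ, .refl β⟩
    obtain ⟨a, b, s, hbraid⟩ := Coxeter.exists_braidEquiv_of_not_isReduced M.toCoxeterSystem hβ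
    obtain ⟨β', hβ', htypes⟩ := exists_homotopic_of_braidEquiv hW β hbraid
    obtain ⟨β'', hβ'', hlt⟩ := exists_homotopic_length_lt_of_types_eq β' htypes
    have hlen : (Gallery.types β').length = n := by rw [htypes, ← hbraid.length_eq, hn]
    obtain ⟨γ, hγ, hβγ⟩ := ih _ (hlen ▸ hlt) β'' rfl
    exact ⟨γ, hγ, (hβ'.trans hβ'').trans hβγ⟩

theorem PropertyW.eq_nil (hW : W.PropertyW) {x : W.Chamber} {γ : W.Gallery x x}
    (hγ : W.IsGeodesic γ) (hnull : W.NullHomotopic γ) : γ = Quiver.Path.nil := by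
  have hnil : W.IsGeodesic (Quiver.Path.nil : W.Gallery x x) := by
    simp [IsGeodesic, Gallery.types, CoxeterSystem.IsReduced]
  have hw : W.wLength γ = 1 :=
    (hW x x γ _ hγ hnil hnull).trans M.toCoxeterSystem.wordProd_nil
  apply Gallery.eq_nil_of_types_eq_nil
  rw [← List.length_eq_zero_iff, ← hγ.eq, M.toCoxeterSystem.length_eq_zero_iff]
  exact hw

end Homotopy

namespace Morphism

section Induced

variable {S' S : Type*} {f : S' → S} {N : CoxeterMatrix S'} {M : CoxeterMatrix S}
  {V : WeylData.{u₁, v₁} N} {W : WeylData.{u, v} M} (ω : Morphism f V W)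

theorem induced_faithful_iff : ω.induced.Faithful ↔ ∀ {x y : V.Chamber} (β γ : V.Gallery x y),
    W.Homotopic (ω.gallery β) (ω.gallery γ) → V.Homotopic β γ := by
  constructor
  · intro hω x y β γ h
    exact Quotient.exact (s := V.homotopySetoid x y) <| Functor.map_injective
      (C := V.FundamentalGroupoid) (X := x) (Y := y) ω.induced
      (Quotient.sound (s := W.homotopySetoid _ _) h)
  · refine fun h => ⟨fun {x y} => Quotient.ind₂ fun β γ hβγ => ?_⟩
    exact Quotient.sound (s := V.homotopySetoid x y)
      (h β γ (Quotient.exact (s := W.homotopySetoid _ _) hβγ))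

end Induced

section RestrictedMatrix

variable {S : Type*} {M : CoxeterMatrix S} {J : Set S} {V : WeylData.{u₁, v₁} (M.restrict J)}
  {W : WeylData.{u, v} M} (ω : Morphism (Subtype.val : J → S) V W)

theorem isGeodesic_gallery {x y : V.Chamber} {γ : V.Gallery x y} (hγ : V.IsGeodesic γ) :
    W.IsGeodesic (ω.gallery γ) := by
  rw [IsGeodesic, ω.types_gallery]
  exact Coxeter.isReduced_map_val _ _ hγ

theorem homotopic_of_homotopic_gallery (hV : V.PW1) (hW : W.PropertyW) {x y : V.Chamber}
    {β γ : V.Gallery x y} (h : W.Homotopic (ω.gallery β) (ω.gallery γ)) : V.Homotopic β γ := by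
  rw [homotopic_iff_nullHomotopic_comp_reverse] at h ⊢
  rw [← ω.gallery_reverse, ← ω.gallery_comp] at h
  obtain ⟨δ, hδ, hβγδ⟩ := exists_isGeodesic_homotopic hV (β.comp γ.reverse)
  have hnil : ω.gallery δ = Quiver.Path.nil :=
    hW.eq_nil (ω.isGeodesic_gallery hδ) ((ω.homotopic hβγδ).symm.trans h)
  have htypes := ω.types_gallery δ
  rw [hnil] at htypes
  rwa [Gallery.eq_nil_of_types_eq_nil (List.map_eq_nil_iff.mp htypes.symm)] at hβγδ

end RestrictedMatrix

end Morphism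

end WeylData

/-! ### Residues -/

namespace GeneralizedChamberSystem

section Full

variable {S : Type*} {W : GeneralizedChamberSystem.{u, v} S} {X : Set W.Chamber}

theorem not_isTrivial_full {s : S} {x y : (W.full X).Chamber} {g : W.PanelHom s x.1 y.1}
    (hg : ¬ W.IsTrivial g) : ¬ (W.full X).IsTrivial (s := s) (x := x) (y := y) g := by
  rintro ⟨rfl, hg'⟩
  exact hg ⟨rfl, hg'⟩

theorem star_fullInclusion_injective (x : (W.full X).Chamber) :
    Function.Injective ((W.fullInclusion X).prefunctor.star x) := by
  rintro ⟨y, s, g, hg⟩ ⟨y', s', g', hg'⟩ h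
  obtain ⟨hy, he⟩ := Sigma.mk.inj h
  obtain rfl := Subtype.ext hy
  obtain ⟨hs, hgg'⟩ := Edge.mk.inj (eq_of_heq he)
  obtain rfl : s = s' := hs
  obtain rfl : g = g' := eq_of_heq hgg'
  rfl

theorem star_fullInclusion_surjective (hX : ∀ {x y : W.Chamber}, W.Edge x y → x ∈ X → y ∈ X)
    (x : (W.full X).Chamber) : Function.Surjective ((W.fullInclusion X).prefunctor.star x) :=
  fun ⟨y, e⟩ => ⟨⟨⟨y, hX e x.2⟩, e.type, e.hom, not_isTrivial_full e.nontrivial⟩, rfl⟩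

theorem fullInclusion_gallery_injective {x y : (W.full X).Chamber} :
    Function.Injective ((W.fullInclusion X).gallery (x := x) (y := y)) := by
  intro γ γ' h
  have hstar := Prefunctor.pathStar_injective (W.fullInclusion X).prefunctor
    star_fullInclusion_injective x (a₁ := ⟨y, γ⟩) (a₂ := ⟨y, γ'⟩) (congrArg (Sigma.mk _) h)
  exact eq_of_heq (Sigma.mk.inj hstar).2

theorem exists_fullInclusion_gallery_eq (hX : ∀ {x y : W.Chamber}, W.Edge x y → x ∈ X → y ∈ X)
    {x : (W.full X).Chamber} {y : W.Chamber} (β : W.Gallery x.1 y) :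
    ∃ (hy : y ∈ X) (γ : (W.full X).Gallery x ⟨y, hy⟩), (W.fullInclusion X).gallery γ = β := by
  obtain ⟨⟨⟨y', hy'⟩, γ⟩, h⟩ := Prefunctor.pathStar_surjective (W.fullInclusion X).prefunctor
    (star_fullInclusion_surjective hX) x ⟨y, β⟩
  obtain ⟨hy, hγ⟩ := Sigma.mk.inj h
  obtain rfl : y' = y := hy
  exact ⟨hy', γ, eq_of_heq hγ⟩

theorem eq_comp_comp_of_fullInclusion_gallery_eq {x y a b : (W.full X).Chamber}
    {γ : (W.full X).Gallery x y} {p : (W.full X).Gallery x a} {c : (W.full X).Gallery a b}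
    {q : (W.full X).Gallery b y}
    (h : (W.fullInclusion X).gallery γ = ((W.fullInclusion X).gallery p).comp
      (((W.fullInclusion X).gallery c).comp ((W.fullInclusion X).gallery q))) :
    γ = p.comp (c.comp q) :=
  fullInclusion_gallery_injective <| by rw [h, Morphism.gallery_comp, Morphism.gallery_comp]

end Full

end GeneralizedChamberSystem

namespace WeylData

section Full

variable {S : Type*} {M : CoxeterMatrix S} {W : WeylData.{u, v} M} {X : Set W.Chamber}

theorem Move.exists_full (hX : ∀ {x y : W.Chamber}, W.Edge x y → x ∈ X → y ∈ X)
    {x y : W.Chamber} {c d : W.Gallery x y} (h : W.Move c d) (hx : x ∈ X) (hy : y ∈ X) :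
    ∃ c' d' : (W.full X).Gallery ⟨x, hx⟩ ⟨y, hy⟩, (W.full X).Move c' d' ∧
      (W.toGeneralizedChamberSystem.fullInclusion X).gallery c' = c ∧
      (W.toGeneralizedChamberSystem.fullInclusion X).gallery d' = d := by
  induction h with
  | @backtrack s x y g hg =>
    have hy : y ∈ X := hX (Edge.mk s g hg) hx
    exact ⟨_, _, .backtrack (W := W.full X) (s := s) (x := ⟨x, hx⟩) (y := ⟨y, hy⟩) g
      (not_isTrivial_full hg), rfl, rfl⟩
  | @shortcut s x y z g h hg hh hgh =>
    have hy' : y ∈ X := hX (Edge.mk s g hg) hx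
    exact ⟨_, _, .shortcut (W := W.full X) (s := s) (x := ⟨x, hx⟩) (y := ⟨y, hy'⟩) (z := ⟨z, hy⟩)
      g h (not_isTrivial_full hg) (not_isTrivial_full hh) (not_isTrivial_full hgh), rfl, rfl⟩
  | @suite s t x θ hθ =>
    obtain ⟨_, θ', rfl⟩ := exists_fullInclusion_gallery_eq hX (x := ⟨x, hx⟩) θ
    exact ⟨θ', Quiver.Path.nil, .suite (W := W.full X) (s := s) (t := t) θ' hθ, rfl, rfl⟩

theorem contraction_full_of_contraction
    (hX : ∀ {x y : W.Chamber}, W.Edge x y → x ∈ X → y ∈ X)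
    {x y : (W.full X).Chamber} {γ γ' : (W.full X).Gallery x y}
    (h : W.Contraction ((W.toGeneralizedChamberSystem.fullInclusion X).gallery γ)
      ((W.toGeneralizedChamberSystem.fullInclusion X).gallery γ')) :
    (W.full X).Contraction γ γ' := by
  generalize hβ : (W.toGeneralizedChamberSystem.fullInclusion X).gallery γ = β at h
  generalize hβ' : (W.toGeneralizedChamberSystem.fullInclusion X).gallery γ' = β' at h
  obtain ⟨p, c, d, q, hm⟩ := h
  obtain ⟨ha, p, rfl⟩ := exists_fullInclusion_gallery_eq hX (x := x) p
  obtain ⟨hb, -, -⟩ := exists_fullInclusion_gallery_eq hX (x := ⟨_, ha⟩) c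
  obtain ⟨_, q, rfl⟩ := exists_fullInclusion_gallery_eq hX (x := ⟨_, hb⟩) q
  obtain ⟨c, d, hm', rfl, rfl⟩ := hm.exists_full hX ha hb
  obtain rfl : γ = p.comp (c.comp q) := eq_comp_comp_of_fullInclusion_gallery_eq hβ
  obtain rfl : γ' = p.comp (d.comp q) := eq_comp_comp_of_fullInclusion_gallery_eq hβ'
  exact ⟨p, c, d, q, hm'⟩

theorem homotopic_full_of_homotopic (hX : ∀ {x y : W.Chamber}, W.Edge x y → x ∈ X → y ∈ X)
    {x y : (W.full X).Chamber} {γ γ' : (W.full X).Gallery x y}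
    (h : W.Homotopic ((W.toGeneralizedChamberSystem.fullInclusion X).gallery γ)
      ((W.toGeneralizedChamberSystem.fullInclusion X).gallery γ')) :
    (W.full X).Homotopic γ γ' := by
  generalize hβ : (W.toGeneralizedChamberSystem.fullInclusion X).gallery γ = β at h
  generalize hβ' : (W.toGeneralizedChamberSystem.fullInclusion X).gallery γ' = β' at h
  induction h generalizing γ γ' with
  | rel β β' h =>
    subst hβ hβ'
    exact .rel _ _ (contraction_full_of_contraction hX h)
  | refl β => exact fullInclusion_gallery_injective (hβ.trans hβ'.symm) ▸ Homotopic.refl γ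
  | symm β β' _ ih => exact (ih hβ' hβ).symm
  | trans β δ β' _ _ ih ih' =>
    obtain ⟨_, δ', hδ⟩ := exists_fullInclusion_gallery_eq hX (x := x) δ
    exact (ih hβ hδ).trans (ih' hδ hβ')

theorem homotopic_component_of_homotopic {C : W.Chamber} {x y : (W.component C).Chamber}
    {γ γ' : (W.component C).Gallery x y}
    (h : W.Homotopic ((W.toGeneralizedChamberSystem.fullInclusion _).gallery γ)
      ((W.toGeneralizedChamberSystem.fullInclusion _).gallery γ')) :
    (W.component C).Homotopic γ γ' :=
  homotopic_full_of_homotopic (X := {D | Nonempty (W.Gallery C D)})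
    (fun e hD => hD.map fun p => Quiver.Path.cons p e) h

end Full

end WeylData

/-! ### Maximal geodesics of a restriction -/

theorem GeneralizedChamberSystem.exists_restrictInclusion_gallery_eq {S : Type*}
    {W : GeneralizedChamberSystem.{u, v} S} {J : Set S} {x y : W.Chamber} (β : W.Gallery x y)
    {l : List J} (h : Gallery.types β = l.map Subtype.val) :
    ∃ γ : (W.restrict J).Gallery x y, (W.restrictInclusion J).gallery γ = β := by
  induction β generalizing l with
  | nil => exact ⟨Quiver.Path.nil, rfl⟩
  | cons p e ih =>
    rw [Gallery.types_cons] at h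
    obtain ⟨l, l', rfl, hp, he⟩ := List.map_eq_append_iff.mp h.symm
    obtain ⟨γ, rfl⟩ := ih hp.symm
    obtain ⟨s, g, hg⟩ := e
    obtain ⟨j, rfl, rfl⟩ := List.map_eq_singleton_iff.mp he
    exact ⟨Quiver.Path.cons γ (Edge.mk (W := W.restrict J) j g hg), rfl⟩

namespace WeylData

section Restrict

variable {S : Type u₃} {M : CoxeterMatrix S} {W : WeylData.{u, v} M} {J : Set S}

theorem IsMaxGeodesic.isSuite_comp_reverse {s t : S} {x y : W.Chamber} {ρ ρ' : W.Gallery x y}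
    (hρ : W.IsMaxGeodesic s t ρ) (hρ' : W.IsMaxGeodesic t s ρ') (h : W.Homotopic ρ ρ') :
    W.IsSuite s t (ρ.comp ρ'.reverse) := by
  refine ⟨hρ.1, hρ.2.1, ?_, homotopic_iff_nullHomotopic_comp_reverse.mp h⟩
  rw [Gallery.types_comp, Gallery.types_reverse, hρ.2.2, hρ'.2.2, M.symmetric t s,
    Coxeter.altWord_append_reverse]

theorem isMaxGeodesic_internal_gallery_iff {s t : J} {x y : (W.restrict J).Chamber}
    {ρ : (W.restrict J).Gallery x y} :
    W.IsMaxGeodesic s t ((W.internal J).gallery ρ) ↔ (W.restrict J).IsMaxGeodesic s t ρ := by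
  rw [IsMaxGeodesic, Morphism.types_gallery, ← altWord_map,
    List.map_inj_right Subtype.val_injective, ne_eq, Subtype.val_inj]
  rfl

theorem isSuite_internal_gallery_comp_reverse {s t : J} {x y : (W.restrict J).Chamber}
    {ρ ρ' : (W.restrict J).Gallery x y} (hρ : (W.restrict J).IsMaxGeodesic s t ρ)
    (hρ' : (W.restrict J).IsMaxGeodesic t s ρ')
    (h : W.Homotopic ((W.internal J).gallery ρ) ((W.internal J).gallery ρ')) :
    W.IsSuite s t ((W.internal J).gallery (ρ.comp ρ'.reverse)) := by
  rw [Morphism.gallery_comp, Morphism.gallery_reverse]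
  exact (isMaxGeodesic_internal_gallery_iff.mpr hρ).isSuite_comp_reverse
    (isMaxGeodesic_internal_gallery_iff.mpr hρ') h

theorem exists_isMaxGeodesic_homotopic_internal_gallery (hW : W.PW1) {s t : J}
    {x y : (W.restrict J).Chamber} {ρ : (W.restrict J).Gallery x y}
    (hρ : (W.restrict J).IsMaxGeodesic s t ρ) :
    ∃ ρ' : (W.restrict J).Gallery x y, (W.restrict J).IsMaxGeodesic t s ρ' ∧
      W.Homotopic ((W.internal J).gallery ρ) ((W.internal J).gallery ρ') := by
  obtain ⟨ρ', hρ', h⟩ := hW s t _ _ _ (isMaxGeodesic_internal_gallery_iff.mpr hρ)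
  have htypes := hρ'.2.2
  rw [← altWord_map] at htypes
  obtain ⟨ρ', rfl⟩ := exists_restrictInclusion_gallery_eq ρ' htypes
  exact ⟨ρ', isMaxGeodesic_internal_gallery_iff.mp hρ', h⟩

theorem PW1.restrict_saturation (hW : W.PW1) (J : Set S) : (W.saturation.restrict J).PW1 := by
  intro s t x y ρ hρ
  obtain ⟨ρ', hρ', h⟩ := exists_isMaxGeodesic_homotopic_internal_gallery (W := W) hW hρ
  exact ⟨ρ', hρ', homotopic_iff_nullHomotopic_comp_reverse.mpr <| .of_move <|
    .suite (s := s) (t := t) _ (isSuite_internal_gallery_comp_reverse (W := W) hρ hρ' h)⟩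

theorem PW1.restrict_of_faithful (hW : W.PW1) (hJ : (W.internal J).induced.Faithful) :
    (W.restrict J).PW1 := by
  intro s t x y ρ hρ
  obtain ⟨ρ', hρ', h⟩ := exists_isMaxGeodesic_homotopic_internal_gallery hW hρ
  exact ⟨ρ', hρ', (W.internal J).induced_faithful_iff.mp hJ ρ ρ' h⟩

end Restrict

end WeylData

theorem isGroupoidEmbedding_iff_faithful {G H : Type*} [Groupoid G] [Groupoid H] {F : G ⥤ H}
    (hF : Function.Injective F.obj) : IsGroupoidEmbedding F ↔ F.Faithful := by
  constructor
  · refine fun h => ⟨fun {x y} a b hab => ?_⟩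
    have hsigma := h (a₁ := ⟨x, y, a⟩) (a₂ := ⟨x, y, b⟩) (by simp only [hab])
    simpa using hsigma
  · rintro h ⟨x, y, a⟩ ⟨x', y', b⟩ hab
    obtain ⟨hx, hab⟩ := Sigma.mk.inj hab
    obtain rfl := hF hx
    obtain ⟨hy, hab⟩ := Sigma.mk.inj (eq_of_heq hab)
    obtain rfl := hF hy
    obtain rfl : a = b := F.map_injective (eq_of_heq hab)
    rfl

theorem mainTheorem11_general {S : Type u₃} (M : CoxeterMatrix S) (W : WeylData.{u, v} M)
    (hPW1 : W.PW1) (hW : W.PropertyW) (J : Set S) :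
    (IsGroupoidEmbedding (W.saturatedInternal J).induced ∧
      ∀ (C : (W.saturation.restrict J).Chamber)
        (x y : ((W.saturation.restrict J).component C).Chamber)
        (γ γ' : ((W.saturation.restrict J).component C).Gallery x y),
        W.Homotopic (W.saturation.ofResidue J C γ) (W.saturation.ofResidue J C γ') →
        ((W.saturation.restrict J).component C).Homotopic γ γ') ∧
    (IsGroupoidEmbedding (W.internal J).induced ↔ (W.restrict J).PW1) ∧
    ((W.restrict J).PW1 →
      ∀ (C : (W.restrict J).Chamber) (x y : ((W.restrict J).component C).Chamber)
        (γ γ' : ((W.restrict J).component C).Gallery x y),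
        W.Homotopic (W.ofResidue J C γ) (W.ofResidue J C γ') →
        ((W.restrict J).component C).Homotopic γ γ') := by
  have hsat {x y} (β γ : (W.saturation.restrict J).Gallery x y) :=
    (W.saturatedInternal J).homotopic_of_homotopic_gallery (β := β) (γ := γ)
      (hPW1.restrict_saturation J) hW
  have hres (hJ : (W.restrict J).PW1) {x y} (β γ : (W.restrict J).Gallery x y) :=
    (W.internal J).homotopic_of_homotopic_gallery (β := β) (γ := γ) hJ hW
  rw [isGroupoidEmbedding_iff_faithful (fun _ _ h => h),
    isGroupoidEmbedding_iff_faithful (fun _ _ h => h)]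
  refine ⟨⟨?_, ?_⟩, ⟨?_, ?_⟩, ?_⟩
  · exact (W.saturatedInternal J).induced_faithful_iff.mpr hsat
  · exact fun C x y γ γ' h => WeylData.homotopic_component_of_homotopic (hsat _ _ h)
  · exact hPW1.restrict_of_faithful
  · exact fun hJ => (W.internal J).induced_faithful_iff.mpr (hres hJ)
  · exact fun hJ C x y γ γ' h => WeylData.homotopic_component_of_homotopic (hres hJ _ _ h)

theorem mainTheorem11 {S : Type u₃} (M : CoxeterMatrix S) (W : WeylData.{u, v} M)
    (hW : W.IsWeylGraph) (J : Set S) :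
    (IsGroupoidEmbedding (W.saturatedInternal J).induced ∧
      ∀ (C : (W.saturation.restrict J).Chamber) (x y : ((W.saturation.restrict J).component C).Chamber)
        (γ γ' : ((W.saturation.restrict J).component C).Gallery x y),
        W.IsGeodesic (W.saturation.ofResidue J C γ) →
        W.IsGeodesic (W.saturation.ofResidue J C γ') →
        W.Homotopic (W.saturation.ofResidue J C γ) (W.saturation.ofResidue J C γ') →
        ((W.saturation.restrict J).component C).Homotopic γ γ') ∧
    (IsGroupoidEmbedding (W.internal J).induced ↔ (W.restrict J).PW1) ∧
    ((W.restrict J).PW1 →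
      ∀ (C : (W.restrict J).Chamber) (x y : ((W.restrict J).component C).Chamber)
        (γ γ' : ((W.restrict J).component C).Gallery x y),
        W.IsGeodesic (W.ofResidue J C γ) →
        W.IsGeodesic (W.ofResidue J C γ') →
        W.Homotopic (W.ofResidue J C γ) (W.ofResidue J C γ') →
        ((W.restrict J).component C).Homotopic γ γ') := by
  obtain ⟨⟨hemb, hhom⟩, hiff, hhomJ⟩ := mainTheorem11_general M W hW.pw1 hW.propertyW J
  exact ⟨⟨hemb, fun C x y γ γ' _ _ => hhom C x y γ γ'⟩, hiff,
    fun hJ C x y γ γ' _ _ => hhomJ hJ C x y γ γ'⟩
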